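/- **Setting.** All matrices are complex, and $A^{(k)}$ denotes the upper left-hand $k\times k$ corner of $A$. A (modified) Cholesky-type factorization of $A$ is a factorization $A=B\,K\,C$ of one of the following types. *General matrices.* (a) LU decomposition ($A$ of size $m\times m$): $K=I$, $B$ nonsingular lower triangular, $C$ upper triangular with diagonal entries $1$. (b) Modified LU decomposition ($A$ of size $m\times m$): $K_{ij}=1$ if $j\in\{i,i+1\}$ and $K_{ij}=0$ otherwise, $B$ nonsingular lower triangular, $C$ nonsingular upper triangular with first row $(1,0,\dots,0)$. (c) Modified Cholesky factorization ($A$ of size $(m-1)\times m$, $m\ge1$): $K$ is the $(m-1)\times m$ matrix with $K_{ij}=1$ if $j\in\{i,i+1\}$ and $K_{ij}=0$ otherwise, $B$ is nonsingular lower triangular of size $m-1$, and $C$ is of size $m$ and as in (b). *Symmetric case.* $A$ of size $m\times m$, $K=I$, $B$ nonsingular lower triangular, $C=B^T$. *Skew-symmetric case.* $A$ of size $m\times m$; $K$ is block diagonal with $2\times2$ diagonal blocks $\begin{pmatrix}0&-1\\1&0\end{pmatrix}$, followed by a zero last row and column if $m$ is odd; $B$ is lower block triangular with $2\times2$ diagonal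 blocks $r\cdot I$ with $r\in\mathbb C\setminus\{0\}$ (depending on the block), and with last diagonal entry $1$ if $m$ is odd; $C=B^T$. In the symmetric case let $V$ be the space of symmetric $m\times m$ matrices, $k=m$ and $f_j(A)=\det A^{(j)}$ for $1\le j\le k$. In the skew-symmetric case let $V$ be the space of skew-symmetric $m\times m$ matrices, $k=\lfloor m/2\rfloor$ and $f_j(A)=\mathrm{Pf}(A^{(2j)})$ for $1\le j\le k$. Let $\mathcal E=\{A\in V: f_j(A)=0\text{ for some }j\}$. The classes $\frac1{2\pi i}\frac{df_j}{f_j}=f_j^*\big(\frac1{2\pi i}\frac{dz}{z}\big)$ on $V\setminus\mathcal E$ are integral. Let $\boldsymbol\omega: H_1(V\setminus\mathcal E,\mathbb Z)\to\mathbb Z^k$ be given by $u\mapsto\big(\langle\frac1{2\pi i}\frac{df_j}{f_j},u\rangle\big)_{1\le j\le k}$, where $\langle\cdot,\cdot\rangle$ is the Kronecker product, and let $\boldsymbol\omega_2: H_1(V\setminus\mathcal E,\mathbb Z)\to(\mathbb Z/2\mathbb Z)^k$ be its reduction mod $2$. (A symmetric or skew-symmetric matrix that has a factorization of the corresponding type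 lies in $V\setminus\mathcal E$.) **Statement.** Let $X$ be a locally path-connected space and let $A_s$, $s\in X$, be a continuous (respectively, with $X$ a smooth manifold, smooth) family of complex matrices of a fixed size such that every $A_s$ has a factorization of one fixed type among those above. Let $\varphi: s\mapsto A_s$. Suppose that either 1. the type is one of the types (a), (b), (c) for general matrices; or 2. the type is the symmetric or the skew-symmetric one, and $\boldsymbol\omega_2\circ\varphi_*=0$ on $H_1(X,\mathbb Z)$, where $\varphi_*: H_1(X,\mathbb Z)\to H_1(V\setminus\mathcal E,\mathbb Z)$. Then there are continuous (respectively smooth) families $B_s$, $C_s$, $s\in X$, such that $A_s=B_s\,K\,C_s$ is a factorization of the same type for all $s\in X$. -/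

import Mathlib

noncomputable section

universe u

namespace CholeskyFamilies

/-! ### Singular homology and winding numbers -/

/-- The first singular homology group `H₁(Y, ℤ)`. -/
abbrev H1 (Y : Type u) [TopologicalSpace Y] : AddCommGrpCat.{u} :=
  ((AlgebraicTopology.singularHomologyFunctor AddCommGrpCat.{u} 1).obj
    (AddCommGrpCat.of (ULift.{u} ℤ))).obj (TopCat.of Y)

/-- The homomorphism `g_* : H₁(Y, ℤ) → H₁(Z, ℤ)` induced by a continuous map `g`. -/
def H1map {Y Z : Type u} [TopologicalSpace Y] [TopologicalSpace Z] (g : C(Y, Z)) :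
    H1 Y →+ H1 Z :=
  (((AlgebraicTopology.singularHomologyFunctor AddCommGrpCat.{u} 1).obj
    (AddCommGrpCat.of (ULift.{u} ℤ))).map (TopCat.ofHom g)).hom

/-- The punctured plane `ℂ*`. -/
abbrev PuncturedPlane : Type := {z : ℂ // z ≠ 0}

/-- A continuous map from a standard simplex to `ℂ*` has a continuous logarithm. -/
theorem exists_log {n : ℕ} (g : C(stdSimplex ℝ (Fin (n + 1)), PuncturedPlane)) :
    ∃ L : C(stdSimplex ℝ (Fin (n + 1)), ℂ), ∀ x, Complex.exp (L x) = g x := by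
  have hne : (stdSimplex ℝ (Fin (n + 1))).Nonempty := ⟨_, single_mem_stdSimplex ℝ 0⟩
  have hc := convex_stdSimplex ℝ (Fin (n + 1))
  have := hc.contractibleSpace hne
  have := hc.locallyPathConnectedSpace
  obtain ⟨L, ⟨-, hL⟩, -⟩ := Complex.isCoveringMap_exp.existsUnique_continuousMap_lifts g
    (stdSimplex.vertex 0) (Complex.log (g (stdSimplex.vertex 0)))
    (Subtype.ext (Complex.exp_log (g _).2))
  exact ⟨L, fun x => congrArg Subtype.val (congrFun hL x)⟩

/-- Two continuous logarithms of the same map have the same increments. -/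
theorem log_increment_unique {n : ℕ} {L L' : C(stdSimplex ℝ (Fin (n + 1)), ℂ)}
    (h : ∀ x, Complex.exp (L x) = Complex.exp (L' x)) (a b : stdSimplex ℝ (Fin (n + 1))) :
    L b - L a = L' b - L' a := by
  have hp : PreconnectedSpace (stdSimplex ℝ (Fin (n + 1))) := inferInstance
  have hL' : ∀ x, Complex.exp (L' x + (L a - L' a)) = Complex.exp (L x) := by
    intro x
    rw [Complex.exp_add, Complex.exp_sub, h a, div_self (Complex.exp_ne_zero _), mul_one, h x]
  have := Complex.isCoveringMap_exp.eq_of_comp_eq (A := stdSimplex ℝ (Fin (n + 1)))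
    (g₁ := fun x => L' x + (L a - L' a)) (g₂ := L) (by fun_prop) (by fun_prop)
    (by funext x; exact Subtype.ext (hL' x)) a (by ring)
  have hb := congrFun this b
  rw [← hb]; ring

/-- The integral `∫_σ dz/z` of the closed form `dz/z` along a (continuous) singular `1`-simplex `σ`
of `ℂ*`: the increment along `σ` of a continuous branch of the logarithm. -/
def dlogIntegral (σ : C(stdSimplex ℝ (Fin 2), PuncturedPlane)) : ℂ :=
  (exists_log σ).choose (stdSimplex.vertex 1) - (exists_log σ).choose (stdSimplex.vertex 0)

theorem dlogIntegral_eq (σ : C(stdSimplex ℝ (Fin 2), PuncturedPlane))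
    (L : C(stdSimplex ℝ (Fin 2), ℂ)) (hL : ∀ x, Complex.exp (L x) = σ x) :
    dlogIntegral σ = L (stdSimplex.vertex 1) - L (stdSimplex.vertex 0) :=
  log_increment_unique (fun x => ((exists_log σ).choose_spec x).trans (hL x).symm) _ _

section Cochain

open CategoryTheory Simplicial

variable {Y : Type u} [TopologicalSpace Y] {A A' : Type} [AddCommGroup A] [AddCommGroup A']

/-- The singular chain complex of `Y` with integral coefficients. -/
abbrev singularChains (Y : Type u) [TopologicalSpace Y] : ChainComplex AddCommGrpCat.{u} ℕ :=
  (TopCat.toSSet.obj (TopCat.of Y)).chainComplex (AddCommGrpCat.of (ULift.{u} ℤ))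

/-- The `A`-valued `n`-cochain, i.e. the homomorphism on singular `n`-chains, with prescribed values
on the singular `n`-simplices. -/
def cochain (n : ℕ) (c : C(stdSimplex ℝ (Fin (n + 1)), Y) → A) :
    (singularChains Y).X n ⟶ AddCommGrpCat.of (ULift.{u} A) :=
  Limits.Sigma.desc fun x : (TopCat.toSSet.obj (TopCat.of Y)) _⦋n⦌ =>
    AddCommGrpCat.ofHom
      (AddMonoidHom.mk'
        (fun k : ULift.{u} ℤ => (⟨k.down • c (TopCat.toSSetObjEquiv _ _ x)⟩ : ULift.{u} A))
        (fun a b => by ext; exact add_smul _ _ _))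

theorem ι_cochain (n : ℕ) (c : C(stdSimplex ℝ (Fin (n + 1)), Y) → A)
    (x : (TopCat.toSSet.obj (TopCat.of Y)) _⦋n⦌) (k : ULift.{u} ℤ) :
    (SSet.ιChainComplex (R := AddCommGrpCat.of (ULift.{u} ℤ)) _ x ≫ cochain n c) k
      = ⟨k.down • c (TopCat.toSSetObjEquiv _ _ x)⟩ := by
  unfold cochain SSet.ιChainComplex
  erw [Limits.Sigma.ι_desc]
  rfl

theorem cochain_add (n : ℕ) (c c' : C(stdSimplex ℝ (Fin (n + 1)), Y) → A) :
    cochain n (fun σ => c σ + c' σ) = cochain n c + cochain n c' := by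
  apply SSet.chainComplex_hom_ext
  intro x
  ext k
  rw [Preadditive.comp_add, ι_cochain]
  change _ = ((SSet.ιChainComplex (R := AddCommGrpCat.of (ULift.{u} ℤ)) _ x ≫ cochain n c) k +
    (SSet.ιChainComplex (R := AddCommGrpCat.of (ULift.{u} ℤ)) _ x ≫ cochain n c') k).down
  rw [ι_cochain, ι_cochain]
  exact smul_add _ _ _

/-- Change of coefficients. -/
def coeffMap (φ : A →+ A') : AddCommGrpCat.of (ULift.{u} A) ⟶ AddCommGrpCat.of (ULift.{u} A') :=
  AddCommGrpCat.ofHom (AddMonoidHom.mk' (fun a : ULift.{u} A => (⟨φ a.down⟩ : ULift.{u} A'))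
    (fun a b => by ext; exact map_add φ _ _))

theorem cochain_comp (n : ℕ) (c : C(stdSimplex ℝ (Fin (n + 1)), Y) → A) (φ : A →+ A') :
    cochain n (fun σ => φ (c σ)) = cochain n c ≫ coeffMap φ := by
  apply SSet.chainComplex_hom_ext
  intro x
  ext k
  rw [ι_cochain]
  change _ = (coeffMap φ
    ((SSet.ιChainComplex (R := AddCommGrpCat.of (ULift.{u} ℤ)) _ x ≫ cochain n c) k)).down
  rw [ι_cochain]
  exact (map_zsmul φ _ _).symm

/-- The `i`-th face of a singular simplex. -/
def face {n : ℕ} (i : Fin (n + 2)) (σ : C(stdSimplex ℝ (Fin (n + 2)), Y)) :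
    C(stdSimplex ℝ (Fin (n + 1)), Y) :=
  σ.comp ⟨stdSimplex.map (Fin.succAbove i), stdSimplex.continuous_map _⟩

theorem toSSetObjEquiv_δ {n : ℕ} (i : Fin (n + 2))
    (x : (TopCat.toSSet.obj (TopCat.of Y)) _⦋n + 1⦌) :
    TopCat.toSSetObjEquiv _ _ ((TopCat.toSSet.obj (TopCat.of Y)).δ i x)
      = face i (TopCat.toSSetObjEquiv _ _ x) := by
  rfl

theorem ι_d_cochain (n : ℕ) (c : C(stdSimplex ℝ (Fin (n + 1)), Y) → A)
    (x : (TopCat.toSSet.obj (TopCat.of Y)) _⦋n + 1⦌) (k : ULift.{u} ℤ) :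
    (SSet.ιChainComplex (R := AddCommGrpCat.of (ULift.{u} ℤ)) _ x ≫
        (singularChains Y).d (n + 1) n ≫ cochain n c) k =
      ⟨k.down • ∑ i : Fin (n + 2), (-1 : ℤ) ^ (i : ℕ) •
        c (face i (TopCat.toSSetObjEquiv _ _ x))⟩ := by
  rw [SSet.ιChainComplex_d_assoc, Preadditive.sum_comp]
  have h : ∀ i : Fin (n + 2), (((-1 : ℤ) ^ (i : ℕ) •
      SSet.ιChainComplex (R := AddCommGrpCat.of (ULift.{u} ℤ)) _
        ((TopCat.toSSet.obj (TopCat.of Y)).δ i x)) ≫ cochain n c) k =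
      (⟨k.down • ((-1 : ℤ) ^ (i : ℕ) • c (face i (TopCat.toSSetObjEquiv _ _ x)))⟩ :
        ULift.{u} A) := by
    intro i
    rw [Preadditive.zsmul_comp]
    have := ι_cochain n c ((TopCat.toSSet.obj (TopCat.of Y)).δ i x) k
    rw [toSSetObjEquiv_δ] at this
    change (-1 : ℤ) ^ (i : ℕ) • ((SSet.ιChainComplex (R := AddCommGrpCat.of (ULift.{u} ℤ)) _
      ((TopCat.toSSet.obj (TopCat.of Y)).δ i x) ≫ cochain n c) k) = _
    rw [this]
    apply ULift.ext
    exact smul_comm _ _ _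
  let e : ((AddCommGrpCat.of (ULift.{u} ℤ)) ⟶ AddCommGrpCat.of (ULift.{u} A)) →+ A :=
    AddMonoidHom.mk' (fun f => (f k).down) (fun _ _ => rfl)
  have he : ∀ f, f k = (⟨e f⟩ : ULift.{u} A) := fun _ => rfl
  rw [he, map_sum, Finset.smul_sum]
  exact congrArg ULift.up (Finset.sum_congr rfl fun i _ => congrArg ULift.down (h i))

theorem d_cochain (n : ℕ) (c : C(stdSimplex ℝ (Fin (n + 1)), Y) → A) :
    (singularChains Y).d (n + 1) n ≫ cochain n c =
      cochain (n + 1) (fun σ => ∑ i : Fin (n + 2), (-1 : ℤ) ^ (i : ℕ) • c (face i σ)) := by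
  apply SSet.chainComplex_hom_ext
  intro x
  ext k
  rw [ι_d_cochain, ι_cochain]

/-- The `1`-cocycle condition. -/
def IsCocycle (c : C(stdSimplex ℝ (Fin 2), Y) → A) : Prop :=
  ∀ σ : C(stdSimplex ℝ (Fin 3), Y), c (face 0 σ) - c (face 1 σ) + c (face 2 σ) = 0

theorem IsCocycle.d_comp {c : C(stdSimplex ℝ (Fin 2), Y) → A} (hc : IsCocycle c) :
    (singularChains Y).d 2 1 ≫ cochain 1 c = 0 := by
  rw [d_cochain]
  apply SSet.chainComplex_hom_ext
  intro x
  ext k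
  rw [ι_cochain]
  have := hc (TopCat.toSSetObjEquiv _ _ x)
  rw [Limits.comp_zero]
  change k.down • (∑ i : Fin 3, (-1 : ℤ) ^ (i : ℕ) • c (face i _)) = 0
  rw [Fin.sum_univ_three]
  convert! smul_zero k.down using 2
  rw [← this]
  simp [sub_eq_add_neg]

/-- The Kronecker product of the cohomology class of a `1`-cocycle `c` with homology classes: the
class of a cycle `∑ n_σ σ` is sent to `∑ n_σ c(σ)`. -/
def kronecker (c : C(stdSimplex ℝ (Fin 2), Y) → A) (hc : IsCocycle c) : H1 Y →+ A :=
  AddEquiv.ulift.toAddMonoidHom.comp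
    (HomologicalComplex.homologyι (singularChains Y) 1 ≫
      HomologicalComplex.descOpcycles (singularChains Y) (cochain 1 c) 2 (by simp) hc.d_comp).hom

/-- Every class in `H₁` is the class of a `1`-cycle, on which the Kronecker products can be
computed. -/
theorem exists_cycle (u : H1 Y) : ∃ z : (singularChains Y).X 1,
    (singularChains Y).d 1 0 z = 0 ∧ ∀ {A : Type} [AddCommGroup A]
      (c : C(stdSimplex ℝ (Fin 2), Y) → A) (hc : IsCocycle c),
      kronecker c hc u = (cochain 1 c z).down := by
  have hs : Function.Surjective ((singularChains Y).homologyπ 1) :=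
    (AddCommGrpCat.epi_iff_surjective _).1 inferInstance
  obtain ⟨z, rfl⟩ := hs u
  refine ⟨(singularChains Y).iCycles 1 z, ?_, ?_⟩
  · change ((singularChains Y).iCycles 1 ≫ (singularChains Y).d 1 0) z = 0
    rw [HomologicalComplex.iCycles_d]
    rfl
  · intro A _ c hc
    change (((singularChains Y).homologyπ 1 ≫ (singularChains Y).homologyι 1 ≫
      HomologicalComplex.descOpcycles (singularChains Y) (cochain 1 c) 2 (by simp) hc.d_comp)
        z).down = (((singularChains Y).iCycles 1 ≫ cochain 1 c) z).down
    rw [HomologicalComplex.homology_π_ι_assoc, HomologicalComplex.p_descOpcycles]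

end Cochain

section Winding

open CategoryTheory

variable {Y : Type u} [TopologicalSpace Y]

/-- For `g : Y → ℂ*`, the integral of `(1/2πi) g^*(dz/z) = (1/2πi) dg/g` along singular
`1`-simplices of `Y`. -/
def dlogCochain (g : C(Y, PuncturedPlane)) (σ : C(stdSimplex ℝ (Fin 2), Y)) : ℂ :=
  1 / (2 * Real.pi * Complex.I) * dlogIntegral (g.comp σ)

theorem dlogCochain_isCocycle (g : C(Y, PuncturedPlane)) : IsCocycle (dlogCochain g) := by
  intro σ
  obtain ⟨L, hL⟩ := exists_log (g.comp σ)
  have h : ∀ i : Fin 3, dlogCochain g (face i σ) = 1 / (2 * Real.pi * Complex.I) *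
      (L (stdSimplex.vertex (i.succAbove 1)) - L (stdSimplex.vertex (i.succAbove 0))) := by
    intro i
    unfold dlogCochain
    rw [dlogIntegral_eq (g.comp (face i σ)) (face i L) (fun x => hL _)]
    simp only [face, ContinuousMap.comp_apply, ContinuousMap.coe_mk, stdSimplex.map_vertex]
  rw [h, h, h]
  have e1 : (0 : Fin 3).succAbove (1 : Fin 2) = 2 := rfl
  have e2 : (0 : Fin 3).succAbove (0 : Fin 2) = 1 := rfl
  have e3 : (1 : Fin 3).succAbove (1 : Fin 2) = 2 := rfl
  have e4 : (1 : Fin 3).succAbove (0 : Fin 2) = 0 := rfl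
  have e5 : (2 : Fin 3).succAbove (1 : Fin 2) = 1 := rfl
  have e6 : (2 : Fin 3).succAbove (0 : Fin 2) = 0 := rfl
  rw [e1, e2, e3, e4, e5, e6]
  ring

/-- `u ↦ ⟨(1/2πi) dg/g, u⟩`, the Kronecker product, with complex values. -/
def dlogPairing (g : C(Y, PuncturedPlane)) : H1 Y →+ ℂ :=
  kronecker (dlogCochain g) (dlogCochain_isCocycle g)

/-- The class of `(1/2πi) dg/g` is integral. -/
theorem dlogPairing_integral (g : C(Y, PuncturedPlane)) (u : H1 Y) :
    ∃ n : ℤ, (n : ℂ) = dlogPairing g u := by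
  have hpi : (2 * Real.pi * Complex.I : ℂ) ≠ 0 := Complex.two_pi_I_ne_zero
  let b : C(stdSimplex ℝ (Fin 1), Y) → ℂ := fun τ =>
    1 / (2 * Real.pi * Complex.I) * Complex.log (g (τ (stdSimplex.vertex 0)))
  have key : ∀ σ : C(stdSimplex ℝ (Fin 2), Y), ∃ n : ℤ,
      dlogCochain g σ = n + (b (face 0 σ) - b (face 1 σ)) := by
    intro σ
    obtain ⟨L, hL⟩ := exists_log (g.comp σ)
    have hlog : ∀ x, ∃ n : ℤ, L x = Complex.log (g (σ x)) + n * (2 * Real.pi * Complex.I) :=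
      fun x => Complex.exp_eq_exp_iff_exists_int.1
        ((hL x).trans (Complex.exp_log (g (σ x)).2).symm)
    obtain ⟨n1, h1⟩ := hlog (stdSimplex.vertex 1)
    obtain ⟨n0, h0⟩ := hlog (stdSimplex.vertex 0)
    refine ⟨n1 - n0, ?_⟩
    have f0 : (face 0 σ) (stdSimplex.vertex 0) = σ (stdSimplex.vertex 1) := by
      simp [face]
    have f1 : (face 1 σ) (stdSimplex.vertex 0) = σ (stdSimplex.vertex 0) := by
      simp [face]
    simp only [b, f0, f1, dlogCochain]
    rw [dlogIntegral_eq _ L hL, h1, h0]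
    push_cast
    field_simp
    ring
  choose n hn using key
  obtain ⟨z, hz, hk⟩ := exists_cycle u
  refine ⟨(cochain 1 n z).down, ?_⟩
  have hc : cochain 1 (dlogCochain g) =
      cochain 1 n ≫ coeffMap (Int.castAddHom ℂ) + (singularChains Y).d 1 0 ≫ cochain 0 b := by
    rw [← cochain_comp, d_cochain, ← cochain_add]
    congr 1
    funext σ
    rw [hn σ, Fin.sum_univ_two]
    simp [sub_eq_add_neg]
  rw [dlogPairing, hk, hc]
  have : (cochain 0 b) ((singularChains Y).d 1 0 z) = 0 := by rw [hz, map_zero]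
  change _ = ((cochain 1 n z).down : ℂ) + ((cochain 0 b) ((singularChains Y).d 1 0 z)).down
  rw [this]
  exact (add_zero _).symm

/-- The homomorphism `H₁(Y, ℤ) → ℤ`, `u ↦ ⟨(1/2πi) dg/g, u⟩`. -/
def dlogPairingInt (g : C(Y, PuncturedPlane)) : H1 Y →+ ℤ :=
  AddMonoidHom.mk' (fun u => (dlogPairing_integral g u).choose) (fun u v => by
    have h := (dlogPairing_integral g (u + v)).choose_spec
    have h' := h.trans ((map_add (dlogPairing g) u v).trans (congrArg₂ (· + ·)
      (dlogPairing_integral g u).choose_spec.symm (dlogPairing_integral g v).choose_spec.symm))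
    exact_mod_cast h')

theorem dlogPairingInt_cast (g : C(Y, PuncturedPlane)) (u : H1 Y) :
    (dlogPairingInt g u : ℂ) = dlogPairing g u :=
  (dlogPairing_integral g u).choose_spec

end Winding

/-! ### The types of (modified) Cholesky-type factorization -/

/-- A type of factorization `A = B * K * C` of `rows × cols` complex matrices: a fixed matrix `K`
and the set of admissible pairs `(B, C)`. -/
structure FactorizationType where
  rows : ℕ
  cols : ℕ
  K : Matrix (Fin rows) (Fin cols) ℂ
  factors : Set (Matrix (Fin rows) (Fin rows) ℂ × Matrix (Fin cols) (Fin cols) ℂ)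

/-- `A = B * K * C` is a factorization of the type `T`. -/
def FactorizationType.IsFactorization (T : FactorizationType)
    (A : Matrix (Fin T.rows) (Fin T.cols) ℂ) (B : Matrix (Fin T.rows) (Fin T.rows) ℂ)
    (C : Matrix (Fin T.cols) (Fin T.cols) ℂ) : Prop :=
  (B, C) ∈ T.factors ∧ A = B * T.K * C

/-- The group of nonsingular lower triangular matrices. -/
def lowerBorel (m : ℕ) : Set (Matrix (Fin m) (Fin m) ℂ) :=
  {B | (∀ i j, i < j → B i j = 0) ∧ ∀ i, B i i ≠ 0}

/-- The group of upper triangular matrices with `1`'s on the diagonal. -/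
def upperUnipotent (m : ℕ) : Set (Matrix (Fin m) (Fin m) ℂ) :=
  {C | (∀ i j, j < i → C i j = 0) ∧ ∀ i, C i i = 1}

/-- The group of nonsingular upper triangular matrices with first diagonal entry `1` and remaining
entries of the first row `0`. -/
def upperModified (m : ℕ) : Set (Matrix (Fin m) (Fin m) ℂ) :=
  {C | (∀ i j, j < i → C i j = 0) ∧ (∀ i, C i i ≠ 0) ∧
    ∀ i j : Fin m, (i : ℕ) = 0 → C i j = if (j : ℕ) = 0 then 1 else 0}

/-- The group of lower block triangular `m × m` matrices with `2 × 2` diagonal blocks `r • 1`,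
`r ≠ 0`, and with last diagonal entry `1` if `m` is odd.  (The entries `i`, `j` belong to the same
block iff `i / 2 = j / 2`.) -/
def skewBorel (m : ℕ) : Set (Matrix (Fin m) (Fin m) ℂ) :=
  {B | (∀ i j : Fin m, (i : ℕ) / 2 < (j : ℕ) / 2 → B i j = 0) ∧
    (∀ i j : Fin m, (i : ℕ) / 2 = (j : ℕ) / 2 → i ≠ j → B i j = 0) ∧
    (∀ i j : Fin m, (i : ℕ) / 2 = (j : ℕ) / 2 → B i i = B j j) ∧
    (∀ i, B i i ≠ 0) ∧
    ∀ i : Fin m, Odd m → (i : ℕ) + 1 = m → B i i = 1}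

/-- The block diagonal `m × m` matrix with `2 × 2` diagonal blocks `(0 -1; 1 0)`, with a zero last
row and column if `m` is odd. -/
def skewJ (m : ℕ) : Matrix (Fin m) (Fin m) ℂ := Matrix.of fun i j =>
  if Even (i : ℕ) ∧ (j : ℕ) = i + 1 then -1 else if Even (j : ℕ) ∧ (i : ℕ) = j + 1 then 1 else 0

/-- The `p × q` matrix with `1`'s on the diagonal and on the superdiagonal and `0`'s elsewhere. -/
def bidiagonal (p q : ℕ) : Matrix (Fin p) (Fin q) ℂ := Matrix.of fun i j =>
  if (j : ℕ) = i ∨ (j : ℕ) = i + 1 then 1 else 0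

/-- The types of factorization for general matrices: the LU decomposition and the modified LU
decomposition of `m × m` matrices, and the modified Cholesky factorization of `(m - 1) × m`
matrices, `m ≥ 1`, indexed by `n = m - 1`. -/
inductive GeneralCase : Type
  | lu (m : ℕ)
  | modifiedLU (m : ℕ)
  | modifiedCholesky (n : ℕ)

/-- The factorization types of the general cases. -/
def GeneralCase.type : GeneralCase → FactorizationType
  | .lu m => ⟨m, m, 1, lowerBorel m ×ˢ upperUnipotent m⟩
  | .modifiedLU m => ⟨m, m, bidiagonal m m, lowerBorel m ×ˢ upperModified m⟩
  | .modifiedCholesky n =>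
      ⟨n, n + 1, bidiagonal n (n + 1), lowerBorel n ×ˢ upperModified (n + 1)⟩

/-- The two kinds of (square) matrices for which `C = Bᵀ`. -/
inductive SymmetryKind : Type
  | symmetric
  | skewSymmetric

namespace SymmetryKind

/-- The space of `m × m` complex symmetric, resp. skew-symmetric, matrices. -/
def space : SymmetryKind → (m : ℕ) → Set (Matrix (Fin m) (Fin m) ℂ)
  | symmetric, _ => {A | A.transpose = A}
  | skewSymmetric, _ => {A | A.transpose = -A}

/-- The matrix `K`: the identity, resp. the standard skew-symmetric matrix. -/
def center : SymmetryKind → (m : ℕ) → Matrix (Fin m) (Fin m) ℂ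
  | symmetric, _ => 1
  | skewSymmetric, m => skewJ m

/-- The group of matrices `B`. -/
def group : SymmetryKind → (m : ℕ) → Set (Matrix (Fin m) (Fin m) ℂ)
  | symmetric, m => lowerBorel m
  | skewSymmetric, m => skewBorel m

/-- The factorization types `A = B * K * Bᵀ` of the symmetric and skew-symmetric cases. -/
def type (κ : SymmetryKind) (m : ℕ) : FactorizationType where
  rows := m
  cols := m
  K := κ.center m
  factors := {p | p.1 ∈ κ.group m ∧ p.2 = p.1.transpose}

end SymmetryKind

/-! ### Basic relative invariants and the obstruction -/

/-- The upper left-hand corner `k × k` submatrix. -/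
def corner {m : ℕ} (A : Matrix (Fin m) (Fin m) ℂ) (k : ℕ) (hk : k ≤ m) :
    Matrix (Fin k) (Fin k) ℂ :=
  A.submatrix (Fin.castLE hk) (Fin.castLE hk)

/-- The Pfaffian of a `2k × 2k` matrix `M`,
`(1 / (2 ^ k k!)) ∑_σ sgn σ ∏_{i < k} M_{σ(2i), σ(2i+1)}`
(where `finProdFinEquiv (i, a) = 2 i + a`). -/
def pfaffian {k : ℕ} (M : Matrix (Fin (k * 2)) (Fin (k * 2)) ℂ) : ℂ :=
  1 / (2 ^ k * (k.factorial : ℂ)) * ∑ σ : Equiv.Perm (Fin (k * 2)), (Equiv.Perm.sign σ : ℤ) *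
    ∏ i : Fin k, M (σ (finProdFinEquiv (i, 0))) (σ (finProdFinEquiv (i, 1)))

namespace SymmetryKind

/-- The number of basic relative invariants. -/
def rank : SymmetryKind → ℕ → ℕ
  | symmetric, m => m
  | skewSymmetric, m => m / 2

/-- The basic relative invariants: the determinants of the corners `A^(j)`, `1 ≤ j ≤ m`, of a
symmetric matrix, resp. the Pfaffians of the corners `A^(2j)`, `1 ≤ j ≤ m / 2`, of a
skew-symmetric matrix (`j : Fin _` stands for `j + 1`). -/
def invariant : (κ : SymmetryKind) → (m : ℕ) → Fin (κ.rank m) → Matrix (Fin m) (Fin m) ℂ → ℂ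
  | symmetric, m, j, A => (corner A (j + 1) (by have := j.2; simp only [rank] at this; omega)).det
  | skewSymmetric, m, j, A =>
      pfaffian (corner A ((j + 1) * 2) (by have := j.2; simp only [rank] at this; omega))

/-- The complement `V \ 𝓔` of the exceptional orbit variety. -/
def complement (κ : SymmetryKind) (m : ℕ) : Set (Matrix (Fin m) (Fin m) ℂ) :=
  {A | A ∈ κ.space m ∧ ∀ j, κ.invariant m j A ≠ 0}

end SymmetryKind

theorem corner_mul_mul {m k : ℕ} (hk : k ≤ m) {B : Matrix (Fin m) (Fin m) ℂ}
    (hB : ∀ i j, i < j → B i j = 0) (K : Matrix (Fin m) (Fin m) ℂ) :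
    corner (B * K * B.transpose) k hk =
      corner B k hk * corner K k hk * (corner B k hk).transpose := by
  have hsum : ∀ (i : Fin k) (f : Fin m → ℂ),
      ∑ x : Fin m, B (Fin.castLE hk i) x * f x =
        ∑ x : Fin k, B (Fin.castLE hk i) (Fin.castLE hk x) * f (Fin.castLE hk x) := by
    intro i f
    refine Eq.trans (Eq.symm ?_) (Finset.sum_map Finset.univ (Fin.castLEEmb hk)
      (fun x => B (Fin.castLE hk i) x * f x))
    apply Finset.sum_subset (Finset.subset_univ _)
    intro x _ hx
    rw [hB, zero_mul]
    by_contra hlt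
    apply hx
    simp only [Finset.mem_map, Finset.mem_univ, true_and]
    refine ⟨⟨x, ?_⟩, rfl⟩
    have h1 : (x : ℕ) ≤ i := by
      have := not_lt.1 hlt
      exact this
    exact lt_of_le_of_lt h1 i.2
  rw [Matrix.mul_assoc, Matrix.mul_assoc]
  ext i j
  have h2 : ∀ x : Fin k, (K * B.transpose) (Fin.castLE hk x) (Fin.castLE hk j) =
      (corner K k hk * (corner B k hk).transpose) x j := by
    intro x
    have := hsum j (fun y => K (Fin.castLE hk x) y)
    simp only [corner, Matrix.mul_apply, Matrix.transpose_apply, Matrix.submatrix_apply]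
    simpa [mul_comm] using this
  change (B * (K * B.transpose)) (Fin.castLE hk i) (Fin.castLE hk j) = _
  rw [Matrix.mul_apply, hsum, Matrix.mul_apply]
  exact Finset.sum_congr rfl fun x _ => congrArg _ (h2 x)

theorem det_corner_ne_zero {m k : ℕ} (hk : k ≤ m) {B : Matrix (Fin m) (Fin m) ℂ}
    (hB : B ∈ lowerBorel m) : (corner B k hk).det ≠ 0 := by
  rw [Matrix.det_of_isLowerTriangular (corner B k hk) (fun i j hij => hB.1 _ _ hij)]
  exact Finset.prod_ne_zero_iff.2 fun i _ => hB.2 _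

theorem skewBorel_subset {m : ℕ} {B : Matrix (Fin m) (Fin m) ℂ} (hB : B ∈ skewBorel m) :
    B ∈ lowerBorel m := by
  refine ⟨fun i j hij => ?_, hB.2.2.2.1⟩
  rcases (Nat.div_le_div_right (c := 2) (Fin.lt_def.1 hij).le).lt_or_eq with h | h
  · exact hB.1 i j h
  · exact hB.2.1 i j h hij.ne

section Pfaffian

open Equiv Matrix

/-- The Pfaffian sum with respect to the index set `Fin k × Fin 2`. -/
theorem pfaffian_eq {k : ℕ} (M : Matrix (Fin (k * 2)) (Fin (k * 2)) ℂ) :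
    pfaffian M = 1 / (2 ^ k * (k.factorial : ℂ)) * ∑ σ : Perm (Fin k × Fin 2), (Perm.sign σ : ℤ) *
      ∏ i : Fin k, M (finProdFinEquiv (σ (i, 0))) (finProdFinEquiv (σ (i, 1))) := by
  unfold pfaffian
  congr 1
  refine (Fintype.sum_equiv (permCongr finProdFinEquiv) _ _ fun σ => ?_).symm
  simp [Perm.sign_permCongr]

theorem pfaffian_expand {k : ℕ} (B A : Matrix (Fin (k * 2)) (Fin (k * 2)) ℂ) :
    pfaffian (B * A * Bᵀ) = 1 / (2 ^ k * (k.factorial : ℂ)) *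
      ∑ q : Fin k → Fin (k * 2) × Fin (k * 2), (∏ i, A (q i).1 (q i).2) *
        (B.submatrix id fun x => let y := finProdFinEquiv.symm x
          if y.2 = 0 then (q y.1).1 else (q y.1).2).det := by
  unfold pfaffian
  congr 1
  have h : ∀ a b, (B * A * Bᵀ) a b = ∑ p : Fin (k * 2) × Fin (k * 2), A p.1 p.2 * (B a p.1 * B b p.2) := by
    intro a b
    rw [Fintype.sum_prod_type, Finset.sum_comm]
    simp only [Matrix.mul_apply, transpose_apply, Finset.sum_mul]
    exact Finset.sum_congr rfl fun _ _ => Finset.sum_congr rfl fun _ _ => by ring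
  simp only [h, Finset.prod_univ_sum, Fintype.piFinset_univ, Finset.mul_sum, Matrix.det_apply']
  rw [Finset.sum_comm]
  refine Finset.sum_congr rfl fun q _ => Finset.sum_congr rfl fun σ _ => ?_
  rw [Finset.prod_mul_distrib, ← finProdFinEquiv.prod_comp, Fintype.prod_prod_type]
  simp only [Fin.prod_univ_two, submatrix_apply, id, symm_apply_apply]
  simp
  ring

theorem pfaffian_mul_mul_transpose {k : ℕ} (B A : Matrix (Fin (k * 2)) (Fin (k * 2)) ℂ) :
    pfaffian (B * A * Bᵀ) = B.det * pfaffian A := by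
  have h1 : pfaffian A = pfaffian (1 * A * (1 : Matrix (Fin (k * 2)) (Fin (k * 2)) ℂ)ᵀ) := by simp
  rw [h1, pfaffian_expand, pfaffian_expand, mul_left_comm, Finset.mul_sum _ _ B.det]
  congr 1
  refine Finset.sum_congr rfl fun q _ => ?_
  rw [mul_left_comm, ← Matrix.det_mul]
  congr 2
  ext i j
  simp [Matrix.mul_apply, Matrix.one_apply]

theorem pfaffian_corner_skewJ_ne_zero {m k : ℕ} (hk : k * 2 ≤ m) :
    pfaffian (corner (skewJ m) (k * 2) hk) ≠ 0 := by
  have hJ : ∀ x y : Fin k × Fin 2, corner (skewJ m) (k * 2) hk (finProdFinEquiv x)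
      (finProdFinEquiv y) = if x.1 = y.1 then (if x.2 = 0 ∧ y.2 = 1 then -1 else
        if x.2 = 1 ∧ y.2 = 0 then 1 else 0) else 0 := by
    rintro ⟨i, a⟩ ⟨j, b⟩
    simp only [corner, skewJ, submatrix_apply, of_apply, Fin.val_castLE, finProdFinEquiv_apply_val,
      Fin.ext_iff, Nat.even_iff]
    have ha := a.2
    have hb := b.2
    simp only [Fin.val_zero, Fin.val_one]
    split_ifs <;> first | rfl | omega
  -- every permutation contributes `0` or `(-1) ^ k`
  have hterm : ∀ σ : Perm (Fin k × Fin 2), ((Perm.sign σ : ℤ) : ℂ) *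
      ∏ i : Fin k, corner (skewJ m) (k * 2) hk (finProdFinEquiv (σ (i, 0)))
        (finProdFinEquiv (σ (i, 1))) = 0 ∨
      ((Perm.sign σ : ℤ) : ℂ) *
      ∏ i : Fin k, corner (skewJ m) (k * 2) hk (finProdFinEquiv (σ (i, 0)))
        (finProdFinEquiv (σ (i, 1))) = (-1) ^ k := by
    intro σ
    simp only [hJ]
    by_cases h1 : ∀ i, (σ (i, 0)).1 = (σ (i, 1)).1
    swap
    · left
      push Not at h1
      obtain ⟨i, hi⟩ := h1
      exact mul_eq_zero_of_right _ (Finset.prod_eq_zero (Finset.mem_univ i) (if_neg hi))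
    right
    have hinj : Function.Injective fun i => (σ (i, 0)).1 := by
      intro i j hij
      by_contra hne
      have hij' : (σ (i, 0)).1 = (σ (j, 0)).1 := hij
      have a1 : (σ (i, 0)).2 ≠ (σ (i, 1)).2 := fun h => by
        have := σ.injective (Prod.ext (h1 i) h)
        simp at this
      have a2 : (σ (i, 0)).2 ≠ (σ (j, 0)).2 := fun h => by
        have := σ.injective (Prod.ext hij' h)
        simp at this
        exact hne this
      have a3 : (σ (i, 1)).2 ≠ (σ (j, 0)).2 := fun h => by
        have := σ.injective (Prod.ext ((h1 i).symm.trans hij') h)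
        simp at this
      omega
    let π : Perm (Fin k) := Equiv.ofBijective _ (Finite.injective_iff_bijective.1 hinj)
    let τ : Fin k → Perm (Fin 2) := fun i => if (σ (i, 0)).2 = 0 then 1 else swap 0 1
    have hne : ∀ i, (σ (i, 0)).2 ≠ (σ (i, 1)).2 := fun i h => by
      have := σ.injective (Prod.ext (h1 i) h)
      simp at this
    have hσ : σ = (prodCongrLeft fun _ : Fin 2 => π) * prodCongrRight τ := by
      ext ⟨i, a⟩ : 1
      have h0 := hne i
      have hπ : π i = (σ (i, 0)).1 := rfl
      simp only [Perm.mul_apply, prodCongrRight_apply, prodCongrLeft_apply, hπ, τ]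
      fin_cases a
      · refine Prod.ext rfl ?_
        simp only [Fin.zero_eta]
        split_ifs with h
        · simpa using h
        · simp; omega
      · refine Prod.ext (h1 i).symm ?_
        simp only [Fin.mk_one]
        split_ifs with h
        · simp; omega
        · simp; omega
    have hsign : ((Perm.sign σ : ℤ) : ℂ) = ∏ i, ((Perm.sign (τ i) : ℤ) : ℂ) := by
      rw [hσ, Perm.sign_mul, Perm.sign_prodCongrLeft, Perm.sign_prodCongrRight]
      simp
    rw [hsign, ← Finset.prod_mul_distrib, Finset.prod_congr rfl (g := fun _ => (-1 : ℂ))]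
    · simp
    intro i _
    have h0 := hne i
    simp only [h1 i, if_true, τ]
    by_cases h : (σ (i, 0)).2 = 0
    · have h' : (σ (i, 1)).2 = 1 := by omega
      simp [h, h']
    · have h2 : (σ (i, 0)).2 = 1 := by omega
      have h' : (σ (i, 1)).2 = 0 := by omega
      simp [h2, h']
  have hid : ((Perm.sign (1 : Perm (Fin k × Fin 2)) : ℤ) : ℂ) *
      ∏ i : Fin k, corner (skewJ m) (k * 2) hk (finProdFinEquiv ((1 : Perm (Fin k × Fin 2)) (i, 0)))
        (finProdFinEquiv ((1 : Perm (Fin k × Fin 2)) (i, 1))) ≠ 0 := by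
    simp only [hJ]
    simp
  rw [pfaffian_eq]
  refine mul_ne_zero (one_div_ne_zero (mul_ne_zero (pow_ne_zero _ two_ne_zero)
    (Nat.cast_ne_zero.2 k.factorial_ne_zero))) ?_
  rw [← Finset.sum_filter_add_sum_filter_not Finset.univ (fun σ : Perm (Fin k × Fin 2) =>
    ((Perm.sign σ : ℤ) : ℂ) * ∏ i : Fin k, corner (skewJ m) (k * 2) hk
      (finProdFinEquiv (σ (i, 0))) (finProdFinEquiv (σ (i, 1))) = 0),
    Finset.sum_eq_zero (fun σ hσ => (Finset.mem_filter.1 hσ).2), zero_add,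
    Finset.sum_congr rfl (fun σ hσ => (hterm σ).resolve_left (Finset.mem_filter.1 hσ).2),
    Finset.sum_const, nsmul_eq_mul]
  refine mul_ne_zero (Nat.cast_ne_zero.2 (Finset.card_ne_zero.2 ⟨1, ?_⟩)) (by simp)
  exact Finset.mem_filter.2 ⟨Finset.mem_univ _, hid⟩

end Pfaffian

/-- A matrix with a factorization lies in the complement of the exceptional orbit variety. -/
theorem mem_complement (κ : SymmetryKind) (m : ℕ) {A B C : Matrix (Fin m) (Fin m) ℂ}
    (h : (κ.type m).IsFactorization A B C) : A ∈ κ.complement m := by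
  obtain ⟨⟨hB, hC⟩, hA⟩ := h
  change B ∈ κ.group m at hB
  change C = B.transpose at hC
  change A = B * κ.center m * C at hA
  subst hC
  cases κ with
  | symmetric =>
    change A = B * 1 * B.transpose at hA
    refine ⟨?_, fun j => ?_⟩
    · change A.transpose = A
      rw [hA]
      simp
    · change (corner A (j + 1) _).det ≠ 0
      have hj : (j : ℕ) + 1 ≤ m := j.2
      have h1 : (corner (1 : Matrix (Fin m) (Fin m) ℂ) (j + 1) hj) = 1 :=
        Matrix.submatrix_one _ (Fin.castLE_injective hj)
      rw [hA, corner_mul_mul _ hB.1, h1, mul_one, Matrix.det_mul, Matrix.det_transpose]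
      exact mul_ne_zero (det_corner_ne_zero hj hB) (det_corner_ne_zero hj hB)
  | skewSymmetric =>
    change A = B * skewJ m * B.transpose at hA
    refine ⟨?_, fun j => ?_⟩
    · change A.transpose = -A
      have hJ : (skewJ m).transpose = -skewJ m := by
        ext i j
        simp only [skewJ, Matrix.transpose_apply, Matrix.of_apply, Matrix.neg_apply]
        split_ifs <;> first | omega | simp
      rw [hA]
      simp [Matrix.transpose_mul, hJ, Matrix.mul_assoc]
    · change pfaffian (corner A ((j + 1) * 2) _) ≠ 0
      have hj : ((j : ℕ) + 1) * 2 ≤ m := by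
        have : (j : ℕ) < m / 2 := j.2
        omega
      rw [hA, corner_mul_mul _ (skewBorel_subset hB).1, pfaffian_mul_mul_transpose]
      exact mul_ne_zero (det_corner_ne_zero hj (skewBorel_subset hB))
        (pfaffian_corner_skewJ_ne_zero hj)

theorem continuous_invariant (κ : SymmetryKind) (m : ℕ) (j : Fin (κ.rank m)) :
    Continuous (κ.invariant m j) := by
  cases κ with
  | symmetric =>
    change Continuous fun A => (corner A (j + 1) _).det
    exact Continuous.matrix_det (continuous_id.matrix_submatrix _ _)
  | skewSymmetric =>
    change Continuous fun A => pfaffian (corner A ((j + 1) * 2) _)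
    unfold pfaffian corner
    simp only [Matrix.submatrix_apply]
    fun_prop

namespace SymmetryKind

/-- A basic relative invariant as a map `V \ 𝓔 → ℂ*`. (The space `V \ 𝓔` is lifted to an
arbitrary universe only in order that it can be compared with an arbitrary space `X`.) -/
def invariantMap (κ : SymmetryKind) (m : ℕ) (j : Fin (κ.rank m)) :
    C(ULift.{u} (κ.complement m), PuncturedPlane) where
  toFun A := ⟨κ.invariant m j A.down, A.down.2.2 j⟩
  continuous_toFun := by
    have := continuous_invariant κ m j
    fun_prop

/-- The homomorphism `𝛚 : H₁(V \ 𝓔, ℤ) → ℤ^k`, whose `j`-th component is the Kronecker product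
with `(1/2πi) df_j/f_j`. -/
def omega (κ : SymmetryKind) (m : ℕ) :
    H1 (ULift.{u} (κ.complement m)) →+ (Fin (κ.rank m) → ℤ) :=
  AddMonoidHom.pi fun j => dlogPairingInt (κ.invariantMap m j)

/-- The composition `𝛚₂` of `𝛚` with the projection `ℤ^k → (ℤ/2ℤ)^k`. -/
def omega2 (κ : SymmetryKind) (m : ℕ) :
    H1 (ULift.{u} (κ.complement m)) →+ (Fin (κ.rank m) → ZMod 2) :=
  ((Int.castAddHom (ZMod 2)).compLeft (Fin (κ.rank m))).comp (κ.omega m)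

/-- A continuous family of matrices with factorizations of the given type, as a map
`φ : X → V \ 𝓔`. -/
def familyMap {X : Type u} [TopologicalSpace X] (κ : SymmetryKind) (m : ℕ)
    (A : X → Matrix (Fin m) (Fin m) ℂ) (hA : Continuous A)
    (h : ∀ s, ∃ B C, (κ.type m).IsFactorization (A s) B C) :
    C(X, ULift.{u} (κ.complement m)) where
  toFun s := ⟨⟨A s, by obtain ⟨B, C, hs⟩ := h s; exact mem_complement κ m hs⟩⟩
  continuous_toFun := continuous_uliftUp.comp (hA.subtype_mk _)

end SymmetryKind

/-! ### Factorizations of families -/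

section Families

open scoped ContDiff Manifold

/-- The family `A_s`, `s ∈ X`, has a continuous factorization of type `T`. -/
def HasContinuousFactorization {X : Type*} [TopologicalSpace X] (T : FactorizationType)
    (A : X → Matrix (Fin T.rows) (Fin T.cols) ℂ) : Prop :=
  ∃ (B : X → Matrix (Fin T.rows) (Fin T.rows) ℂ) (C : X → Matrix (Fin T.cols) (Fin T.cols) ℂ),
    Continuous B ∧ Continuous C ∧ ∀ s, T.IsFactorization (A s) (B s) (C s)

/-- A family of matrices on a manifold is smooth if its entries are smooth (`C^∞`, over `ℝ`). -/
def SmoothFamily {E H X : Type*} [NormedAddCommGroup E] [NormedSpace ℝ E] [TopologicalSpace H]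
    (I : ModelWithCorners ℝ E H) [TopologicalSpace X] [ChartedSpace H X] {p q : ℕ}
    (A : X → Matrix (Fin p) (Fin q) ℂ) : Prop :=
  ∀ i j, ContMDiff I 𝓘(ℝ, ℂ) ∞ fun s => A s i j

/-- The family `A_s`, `s ∈ X`, has a smooth factorization of type `T`. -/
def HasSmoothFactorization {E H X : Type*} [NormedAddCommGroup E] [NormedSpace ℝ E]
    [TopologicalSpace H] (I : ModelWithCorners ℝ E H) [TopologicalSpace X] [ChartedSpace H X]
    (T : FactorizationType) (A : X → Matrix (Fin T.rows) (Fin T.cols) ℂ) : Prop :=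
  ∃ (B : X → Matrix (Fin T.rows) (Fin T.rows) ℂ) (C : X → Matrix (Fin T.cols) (Fin T.cols) ℂ),
    SmoothFamily I B ∧ SmoothFamily I C ∧ ∀ s, T.IsFactorization (A s) (B s) (C s)

end Families

end CholeskyFamilies

end

open scoped ContDiff

noncomputable section

universe u

namespace CholeskyFamilies

/-! For general matrices the factors are determined by `A`: comparing entries of `A = B K C`
expresses those of `B` and `C` recursively by sums, products and quotients with nonvanishing
denominators. Hence any pointwise choice of factors is already as regular as `A` (`entries_lu`,
`entries_bidiagonal`).

In the symmetric and skew-symmetric cases `B` is determined only up to a sign for each diagonal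
block (the last entry of an odd skew matrix being fixed). The products `B i k * B k k` do not see
these signs and are regular (`entries_mul_diag`). So it suffices to choose regular square roots `g
k` of the functions `B k k ^ 2`; dividing the products by `g k` gives the new `B`
(`exists_entries_congruence`). Up to nonzero constants, the invariants `f_j(A)` are the partial
products of these squares over blocks, so roots of the `f_j(A)` give the `g k`
(`exists_sqrt_of_prod`).

A map `X → ℂ*` with even winding numbers has a continuous square root: continue a root along paths
by half the integral of `dz/z` (`exists_sqrt`). Naturality of the Kronecker product turns the
vanishing of `𝛚₂ ∘ φ_*` into this evenness.

`RegularAlgebra` treats continuous and smooth families at once. -/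

open CategoryTheory

/-! ### Naturality of the Kronecker product, and cycles made of paths -/

section Homology

variable {Y Z : Type u} [TopologicalSpace Y] [TopologicalSpace Z]
  {A : Type} [AddCommGroup A]

theorem IsCocycle.comp {c : C(stdSimplex ℝ (Fin 2), Z) → A} (hc : IsCocycle c) (g : C(Y, Z)) :
    IsCocycle fun σ : C(stdSimplex ℝ (Fin 2), Y) => c (g.comp σ) :=
  fun σ => hc (g.comp σ)

theorem chainComplexMap_cochain (n : ℕ) (g : C(Y, Z))
    (c : C(stdSimplex ℝ (Fin (n + 1)), Z) → A) :
    (SSet.chainComplexMap (TopCat.toSSet.map (TopCat.ofHom g))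
      (AddCommGrpCat.of (ULift.{u} ℤ))).f n ≫ cochain n c =
      cochain n fun σ => c (g.comp σ) := by
  apply SSet.chainComplex_hom_ext
  intro x
  ext k
  rw [ι_cochain, SSet.ι_chainComplexMap_f_assoc, ι_cochain]
  rfl

/-- The Kronecker product is natural. -/
theorem kronecker_H1map (g : C(Y, Z)) (c : C(stdSimplex ℝ (Fin 2), Z) → A) (hc : IsCocycle c)
    (v : H1 Y) : kronecker c hc (H1map g v) = kronecker _ (hc.comp g) v := by
  let F := SSet.chainComplexMap (TopCat.toSSet.map (TopCat.ofHom g))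
    (AddCommGrpCat.of (ULift.{u} ℤ))
  have h : HomologicalComplex.homologyMap F 1 ≫
      (HomologicalComplex.homologyι (singularChains Z) 1 ≫
        HomologicalComplex.descOpcycles (singularChains Z) (cochain 1 c) 2 (by simp) hc.d_comp) =
      HomologicalComplex.homologyι (singularChains Y) 1 ≫
        HomologicalComplex.descOpcycles (singularChains Y) (cochain 1 fun σ => c (g.comp σ)) 2
          (by simp) (hc.comp g).d_comp := by
    rw [HomologicalComplex.homologyι_naturality_assoc]
    congr 1
    -- Chains surject onto opcycles, so the two maps may be compared on chains.
    rw [← cancel_epi ((singularChains Y).pOpcycles 1), HomologicalComplex.p_opcyclesMap_assoc,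
      HomologicalComplex.p_descOpcycles, HomologicalComplex.p_descOpcycles]
    exact chainComplexMap_cochain 1 g c
  exact congrArg ULift.down (congrArg (fun f => f.hom v) h)

/-- This moves the obstruction from `V \ 𝓔` to `X`: pulling back the cochain of `f` along `g` gives
the cochain of `f ∘ g` by definition. -/
theorem dlogPairingInt_H1map (g : C(Y, Z)) (f : C(Z, PuncturedPlane)) (v : H1 Y) :
    dlogPairingInt f (H1map g v) = dlogPairingInt (f.comp g) v := by
  have h : dlogPairing f (H1map g v) = dlogPairing (f.comp g) v :=
    kronecker_H1map g _ _ v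
  rw [← dlogPairingInt_cast, ← dlogPairingInt_cast] at h
  exact_mod_cast h

/-- A path as a singular `1`-simplex. -/
def pathSimplex {a b : Y} (γ : Path a b) : C(stdSimplex ℝ (Fin 2), Y) :=
  γ.toContinuousMap.comp ⟨stdSimplexHomeomorphUnitInterval,
    stdSimplexHomeomorphUnitInterval.continuous⟩

theorem pathSimplex_vertex_zero {a b : Y} (γ : Path a b) :
    pathSimplex γ (stdSimplex.vertex 0) = a :=
  γ.source

theorem pathSimplex_vertex_one {a b : Y} (γ : Path a b) :
    pathSimplex γ (stdSimplex.vertex 1) = b :=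
  γ.target

/-- The standard `0`-simplex is a point. Faces of path simplices thus become literally constant
simplices, so boundaries of consecutive paths cancel as chains. -/
theorem zero_simplex_eq_const (τ : C(stdSimplex ℝ (Fin 1), Y)) :
    τ = ContinuousMap.const _ (τ (stdSimplex.vertex 0)) := by
  ext x
  have : x = stdSimplex.vertex 0 := by
    apply stdSimplex.ext
    funext i
    rw [Subsingleton.elim i default, stdSimplex.eq_one_of_unique, stdSimplex.eq_one_of_unique]
  rw [this]
  rfl

theorem face_zero_pathSimplex {a b : Y} (γ : Path a b) :
    face 0 (pathSimplex γ) = ContinuousMap.const _ b := by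
  rw [zero_simplex_eq_const (face 0 _)]
  congr 1
  refine Eq.trans ?_ (pathSimplex_vertex_one γ)
  simp [face]

theorem face_one_pathSimplex {a b : Y} (γ : Path a b) :
    face 1 (pathSimplex γ) = ContinuousMap.const _ a := by
  rw [zero_simplex_eq_const (face 1 _)]
  congr 1
  refine Eq.trans ?_ (pathSimplex_vertex_zero γ)
  simp [face]

/-- The generator of the singular chains defined by a singular simplex. -/
def simplexChain (n : ℕ) (σ : C(stdSimplex ℝ (Fin (n + 1)), Y)) :
    AddCommGrpCat.of (ULift.{u} ℤ) ⟶ (singularChains Y).X n :=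
  SSet.ιChainComplex (TopCat.toSSet.obj (TopCat.of Y))
    ((TopCat.toSSetObjEquiv (TopCat.of Y) _).symm σ)

theorem simplexChain_d (σ : C(stdSimplex ℝ (Fin 2), Y)) :
    simplexChain 1 σ ≫ (singularChains Y).d 1 0 =
      simplexChain 0 (face 0 σ) - simplexChain 0 (face 1 σ) := by
  unfold simplexChain
  rw [SSet.ιChainComplex_d, Fin.sum_univ_two]
  simp only [Fin.val_zero, Fin.val_one, pow_zero, pow_one, one_smul, neg_smul, ← sub_eq_add_neg]
  rfl

/-- The boundary of a triangle of paths is a cycle, on which the Kronecker products with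
`1`-cocycles are the obvious ones. -/
theorem exists_triangle_class {a b c : Y} (α : Path a b) (β : Path b c) (γ : Path a c) :
    ∃ v : H1 Y, ∀ (f : C(stdSimplex ℝ (Fin 2), Y) → A) (hf : IsCocycle f),
      kronecker f hf v = f (pathSimplex α) + f (pathSimplex β) - f (pathSimplex γ) := by
  -- The boundary is `(b - a) + (c - b) - (c - a) = 0`.
  let k := simplexChain 1 (pathSimplex α) + simplexChain 1 (pathSimplex β) -
    simplexChain 1 (pathSimplex γ)
  have hk : k ≫ (singularChains Y).d 1 0 = 0 := by
    simp only [k, Preadditive.add_comp, Preadditive.sub_comp, simplexChain_d,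
      face_zero_pathSimplex, face_one_pathSimplex]
    abel
  refine ⟨((singularChains Y).liftCycles k 0 (by simp) hk ≫ (singularChains Y).homologyπ 1)
    (⟨1⟩ : ULift.{u} ℤ), fun f hf => ?_⟩
  -- Passing from cycles through homology to opcycles is the inclusion of cycles followed by the
  -- projection, so the pairing evaluates the cochain on `k`.
  have h : ((singularChains Y).liftCycles k 0 (by simp) hk ≫ (singularChains Y).homologyπ 1) ≫
      (HomologicalComplex.homologyι (singularChains Y) 1 ≫
        HomologicalComplex.descOpcycles (singularChains Y) (cochain 1 f) 2 (by simp) hf.d_comp) =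
      k ≫ cochain 1 f := by
    rw [Category.assoc, HomologicalComplex.homology_π_ι_assoc,
      HomologicalComplex.liftCycles_i_assoc, HomologicalComplex.p_descOpcycles]
  have h1 : ∀ σ, ((simplexChain 1 σ ≫ cochain 1 f) (⟨1⟩ : ULift.{u} ℤ)).down = f σ := by
    intro σ
    unfold simplexChain
    rw [ι_cochain]
    exact one_smul ℤ _
  refine (congrArg (fun m => ULift.down (m.hom (⟨1⟩ : ULift.{u} ℤ))) h).trans ?_
  simp only [k, Preadditive.add_comp, Preadditive.sub_comp]
  rw [← h1, ← h1, ← h1]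
  rfl

end Homology

/-! ### Square roots of maps to the punctured plane -/

section SquareRoot

variable {X : Type u} [TopologicalSpace X]

theorem exp_dlogIntegral (g : C(X, PuncturedPlane)) {a b : X} (γ : Path a b) :
    (g b : ℂ) = g a * Complex.exp (dlogIntegral (g.comp (pathSimplex γ))) := by
  obtain ⟨L, hL⟩ := exists_log (g.comp (pathSimplex γ))
  rw [dlogIntegral_eq _ L hL, Complex.exp_sub, hL, hL, ContinuousMap.comp_apply,
    ContinuousMap.comp_apply]
  erw [pathSimplex_vertex_zero, pathSimplex_vertex_one]
  exact (mul_div_cancel₀ _ (g a).2).symm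

/-- As long as `g / g a` avoids the cut, its principal logarithm is a continuous branch, and it
starts at `log 1 = 0`. -/
theorem dlogIntegral_eq_log (g : C(X, PuncturedPlane)) {a b : X} (γ : Path a b)
    (hγ : ∀ t, (g (γ t) : ℂ) / g a ∈ Complex.slitPlane) :
    dlogIntegral (g.comp (pathSimplex γ)) = Complex.log (g b / g a) := by
  have ha := (g a).2
  let L : C(stdSimplex ℝ (Fin 2), ℂ) :=
    ⟨fun x => Complex.log (g (pathSimplex γ x) / g a) + Complex.log (g a), by
      refine Continuous.add (Continuous.clog (by fun_prop) fun x => hγ _) continuous_const⟩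
  rw [dlogIntegral_eq _ L]
  · simp only [L, ContinuousMap.coe_mk, pathSimplex_vertex_zero, pathSimplex_vertex_one]
    simp [ha]
  · intro x
    simp only [L, ContinuousMap.coe_mk]
    rw [Complex.exp_add, Complex.exp_log ha, Complex.exp_log (div_ne_zero (g _).2 ha)]
    simp [ha]

/-- The winding number around the triangle is even, so the halved integrals still differ by an
integral multiple of `2πi`. Without evenness the two sides would agree only up to sign. -/
theorem exp_half_dlogIntegral_triangle (g : C(X, PuncturedPlane))
    (hg : ∀ v, Even (dlogPairingInt g v)) {a b c : X} (α : Path a b) (β : Path b c)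
    (γ : Path a c) :
    Complex.exp (dlogIntegral (g.comp (pathSimplex γ)) / 2) =
      Complex.exp (dlogIntegral (g.comp (pathSimplex α)) / 2) *
        Complex.exp (dlogIntegral (g.comp (pathSimplex β)) / 2) := by
  obtain ⟨v, hv⟩ := exists_triangle_class (A := ℂ) α β γ
  have h := hv _ (dlogCochain_isCocycle g)
  obtain ⟨n, hn⟩ := hg v
  have h' := dlogPairingInt_cast g v
  rw [hn] at h'
  have h2 := h'.trans h
  unfold dlogCochain at h2
  have hpi : (2 * Real.pi * Complex.I : ℂ) ≠ 0 := Complex.two_pi_I_ne_zero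
  rw [← Complex.exp_add, Complex.exp_eq_exp_iff_exists_int]
  refine ⟨-n, ?_⟩
  have h3 : (2 * Real.pi * Complex.I : ℂ) * ((n + n : ℤ) : ℂ) =
      dlogIntegral (g.comp (pathSimplex α)) + dlogIntegral (g.comp (pathSimplex β)) -
        dlogIntegral (g.comp (pathSimplex γ)) := by
    rw [h2]
    field_simp
  push_cast at h3 ⊢
  linear_combination h3 / 2

/-- A function to `ℂ*` with even winding numbers has a continuous square root. -/
theorem exists_sqrt [LocallyPathConnectedSpace X] (g : C(X, PuncturedPlane))
    (hg : ∀ v, Even (dlogPairingInt g v)) :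
    ∃ h : X → ℂ, (∀ x, h x ^ 2 = g x) ∧
      ∀ x, ∀ᶠ y in nhds x, h y = h x * Complex.exp (Complex.log (g y / g x) / 2) := by
  -- One base point for each path component, so that points joined by a path share it.
  let base : X → X := fun x => (Quotient.mk (pathSetoid X) x).out
  have hj : ∀ x, Joined (base x) x := fun x =>
    Quotient.exact (Quotient.out_eq (Quotient.mk (pathSetoid X) x))
  -- A root at the base point, continued along an arbitrarily chosen path; the choice is harmless by
  -- the triangle lemma.
  let h : X → ℂ := fun x => Complex.exp (Complex.log (g (base x)) / 2) *
    Complex.exp (dlogIntegral (g.comp (pathSimplex (hj x).somePath)) / 2)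
  refine ⟨h, fun x => ?_, fun x => ?_⟩
  · rw [exp_dlogIntegral g (hj x).somePath, mul_pow, ← Complex.exp_nat_mul, ← Complex.exp_nat_mul,
      Nat.cast_ofNat, mul_div_cancel₀ _ (two_ne_zero' ℂ), mul_div_cancel₀ _ (two_ne_zero' ℂ),
      Complex.exp_log (g _).2]
  · have hx := (g x).2
    -- The quotient is `1` at `y = x`, hence in the slit plane nearby.
    have hU : {y | (g y : ℂ) / g x ∈ Complex.slitPlane} ∈ nhds x := by
      apply ContinuousAt.preimage_mem_nhds (f := fun y => (g y : ℂ) / g x) (by fun_prop)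
      apply Complex.isOpen_slitPlane.mem_nhds
      simp [hx]
    obtain ⟨V, ⟨hV, hVp⟩, hVU⟩ := (LocallyPathConnectedSpace.path_connected_basis x).mem_iff.1 hU
    filter_upwards [hV] with y hy
    obtain ⟨δ, hδ⟩ := hVp.joinedIn x (mem_of_mem_nhds hV) y hy
    have hb : base y = base x :=
      congrArg Quotient.out (Quotient.sound (Joined.symm ⟨δ⟩))
    -- The type of the path chosen for `y` mentions `base y`; generalizing its starting point lets
    -- `base y = base x` be substituted.
    have key : ∀ (z : X) (hz : z = base x) (γ : Path z y),
        Complex.exp (Complex.log (g z) / 2) *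
          Complex.exp (dlogIntegral (g.comp (pathSimplex γ)) / 2) =
        h x * Complex.exp (Complex.log (g y / g x) / 2) := by
      rintro _ rfl γ
      rw [exp_half_dlogIntegral_triangle g hg (hj x).somePath δ γ,
        dlogIntegral_eq_log g δ fun t => hVU (hδ t), ← mul_assoc]
    exact key _ hb _

end SquareRoot


/-! ### Scalar block triangular matrices and algebras of regular functions -/

/-- `B` is lower block triangular with scalar nonsingular diagonal blocks, the blocks being the
fibres of `b`. -/
structure ScalarBlock {m : ℕ} (b : Fin m → ℕ) (B : Matrix (Fin m) (Fin m) ℂ) : Prop where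
  lower : ∀ i j, b i < b j → B i j = 0
  offDiag : ∀ i j, b i = b j → i ≠ j → B i j = 0
  scalar : ∀ i j, b i = b j → B i i = B j j
  ne_zero : ∀ i, B i i ≠ 0

/-- An algebra of complex functions, such as the continuous or the smooth ones, that is closed under
inversion and under continuous square roots of nowhere vanishing functions. -/
structure RegularAlgebra (X : Type u) [TopologicalSpace X] extends Subalgebra ℂ (X → ℂ) where
  inv_mem : ∀ f ∈ toSubalgebra, (∀ x, f x ≠ 0) → (fun x => (f x)⁻¹) ∈ toSubalgebra
  -- The local formula writes `h` near `x` as an analytic function of `g`, which yields continuity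
  -- and smoothness alike.
  sqrt_mem : ∀ g ∈ toSubalgebra, (∀ x, g x ≠ 0) → ∀ h : X → ℂ,
    (∀ x, ∀ᶠ y in nhds x, h y = h x * Complex.exp (Complex.log (g y / g x) / 2)) →
      h ∈ toSubalgebra

namespace RegularAlgebra

variable {X : Type u} [TopologicalSpace X] (R : RegularAlgebra X)

/-- The entries of a family of matrices belong to the algebra `R`. -/
def Entries {p q : ℕ} (A : X → Matrix (Fin p) (Fin q) ℂ) : Prop :=
  ∀ i j, (fun s => A s i j) ∈ R.toSubalgebra

variable {R}

theorem const_mem (c : ℂ) : (fun _ => c) ∈ R.toSubalgebra :=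
  R.toSubalgebra.algebraMap_mem c

theorem div_mem {f g : X → ℂ} (hf : f ∈ R.toSubalgebra) (hg : g ∈ R.toSubalgebra)
    (h : ∀ x, g x ≠ 0) : (fun x => f x / g x) ∈ R.toSubalgebra := by
  simp only [div_eq_mul_inv]
  exact R.toSubalgebra.mul_mem hf (R.inv_mem g hg h)

/-- Used to solve an entry of a matrix product for its only unknown term. -/
theorem mem_of_sum_mem {ι : Type*} [Fintype ι] {F : X → ι → ℂ} {k : ι}
    (hF : (fun s => ∑ i, F s i) ∈ R.toSubalgebra)
    (h : ∀ i, i ≠ k → (fun s => F s i) ∈ R.toSubalgebra) :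
    (fun s => F s k) ∈ R.toSubalgebra := by
  classical
  have : (fun s => F s k) = (fun s => ∑ i, F s i) - ∑ i ∈ Finset.univ.erase k, fun s => F s i := by
    funext s
    rw [Pi.sub_apply, Finset.sum_apply, eq_sub_iff_add_eq,
      Finset.add_sum_erase _ (F s) (Finset.mem_univ k)]
  rw [this]
  exact R.toSubalgebra.sub_mem hF
    (R.toSubalgebra.sum_mem fun i hi => h i (Finset.ne_of_mem_erase hi))

/-! ### General matrices -/

/-- The factors of an LU decomposition are regular. -/
theorem entries_lu {p q : ℕ} (hpq : p ≤ q) {A U : X → Matrix (Fin p) (Fin q) ℂ}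
    {L : X → Matrix (Fin p) (Fin p) ℂ} (hA : R.Entries A) (hLU : ∀ s, A s = L s * U s)
    (hL : ∀ s, L s ∈ lowerBorel p) (hU : ∀ s (i : Fin p) (j : Fin q), (j : ℕ) < i → U s i j = 0)
    (hU1 : ∀ s (i : Fin p), U s i (Fin.castLE hpq i) = 1) : R.Entries L ∧ R.Entries U := by
  -- Induction on `k`: column `k` of `L` comes first, then row `k` of `U`.
  have key : ∀ (n : ℕ) (k : Fin p), (k : ℕ) = n → (∀ i, (fun s => L s i k) ∈ R.toSubalgebra) ∧
      ∀ j, (fun s => U s k j) ∈ R.toSubalgebra := by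
    intro n
    induction n using Nat.strong_induction_on with
    | _ n ih =>
    intro k hk
    have hsum : ∀ i j, (fun s => ∑ l, L s i l * U s l j) ∈ R.toSubalgebra := by
      intro i j
      have := hA i j
      simpa only [hLU, Matrix.mul_apply] using this
    have hLk : ∀ i, (fun s => L s i k) ∈ R.toSubalgebra := by
      intro i
      -- In entry `(i, k)` the terms `l < k` are known, those with `l > k` vanish since `U` is upper
      -- triangular, and `U k k = 1`.
      have := mem_of_sum_mem (k := k) (hsum i (Fin.castLE hpq k)) fun l hl => ?_
      · simpa only [hU1, mul_one] using this
      · rcases lt_or_gt_of_ne hl with hlt | hgt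
        · obtain ⟨h1, h2⟩ := ih l (hk ▸ hlt) l rfl
          exact R.toSubalgebra.mul_mem (h1 i) (h2 _)
        · simpa only [hU _ l (Fin.castLE hpq k) hgt, mul_zero] using const_mem 0
    refine ⟨hLk, fun j => ?_⟩
    -- Entry `(k, j)` leaves `L k k * U k j`, which may be divided by `L k k ≠ 0`.
    have := mem_of_sum_mem (k := k) (hsum k j) fun l hl => ?_
    · have h := div_mem this (hLk k) fun s => (hL s).2 k
      simpa only [mul_div_cancel_left₀ _ ((hL _).2 k)] using h
    · rcases lt_or_gt_of_ne hl with hlt | hgt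
      · obtain ⟨h1, h2⟩ := ih l (hk ▸ hlt) l rfl
        exact R.toSubalgebra.mul_mem (h1 k) (h2 j)
      · simpa only [(hL _).1 k l hgt, zero_mul] using const_mem 0
  exact ⟨fun i k => (key k k rfl).1 i, fun k j => (key k k rfl).2 j⟩

theorem bidiagonal_mul_apply {p q : ℕ} (hpq : p ≤ q) (C : Matrix (Fin q) (Fin q) ℂ) (i : Fin p)
    (j : Fin q) : (bidiagonal p q * C) i j = C (Fin.castLE hpq i) j +
      if h : (i : ℕ) + 1 < q then C ⟨i + 1, h⟩ j else 0 := by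
  rw [Matrix.mul_apply]
  have h1 : ∀ k : Fin q, bidiagonal p q i k * C k j =
      (if k = Fin.castLE hpq i then C k j else 0) + if (k : ℕ) = i + 1 then C k j else 0 := by
    intro k
    simp only [bidiagonal, Matrix.of_apply, Fin.ext_iff, Fin.val_castLE]
    split_ifs <;> first | omega | simp
  rw [Finset.sum_congr rfl fun k _ => h1 k, Finset.sum_add_distrib, Finset.sum_ite_eq' Finset.univ,
    if_pos (Finset.mem_univ _)]
  congr 1
  split_ifs with h
  · have h2 : ∀ k : Fin q, ((k : ℕ) = i + 1) = (k = ⟨i + 1, h⟩) := fun k => by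
      rw [Fin.ext_iff]
    simp only [h2, Finset.sum_ite_eq', Finset.mem_univ, if_true]
  · exact Finset.sum_eq_zero fun k _ => if_neg (by have := k.2; omega)

/-- The factors of a modified LU decomposition are regular. -/
theorem entries_bidiagonal {p q : ℕ} (hpq : p ≤ q) (hqp : q ≤ p + 1)
    {A : X → Matrix (Fin p) (Fin q) ℂ} {B : X → Matrix (Fin p) (Fin p) ℂ}
    {C : X → Matrix (Fin q) (Fin q) ℂ} (hA : R.Entries A)
    (hBC : ∀ s, A s = B s * bidiagonal p q * C s) (hB : ∀ s, B s ∈ lowerBorel p)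
    (hC : ∀ s, C s ∈ upperModified q) : R.Entries B ∧ R.Entries C := by
  have hd : ∀ s (i : Fin p), C s (Fin.castLE hpq i) (Fin.castLE hpq i) ≠ 0 := fun s i =>
    (hC s).2.1 _
  -- The diagonal entries of `K C` are those of `C`, since `C` vanishes below its diagonal. Moving
  -- them to the left factor gives an ordinary LU decomposition.
  let L : X → Matrix (Fin p) (Fin p) ℂ := fun s => Matrix.of fun i k =>
    B s i k * C s (Fin.castLE hpq k) (Fin.castLE hpq k)
  let U : X → Matrix (Fin p) (Fin q) ℂ := fun s => Matrix.of fun k j =>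
    (bidiagonal p q * C s) k j / C s (Fin.castLE hpq k) (Fin.castLE hpq k)
  obtain ⟨hLR, hUR⟩ : R.Entries L ∧ R.Entries U := by
    refine entries_lu hpq hA (fun s => ?_) (fun s => ⟨fun i j hij => ?_, fun i => ?_⟩)
      (fun s i j hij => ?_) fun s i => ?_
    · rw [hBC s, Matrix.mul_assoc]
      ext i j
      rw [Matrix.mul_apply, Matrix.mul_apply]
      refine Finset.sum_congr rfl fun k _ => ?_
      have := hd s k
      simp only [L, U, Matrix.of_apply]
      field_simp
    · simp only [L, Matrix.of_apply, (hB s).1 i j hij, zero_mul]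
    · exact mul_ne_zero ((hB s).2 i) (hd s i)
    · simp only [U, Matrix.of_apply, bidiagonal_mul_apply hpq]
      rw [(hC s).1 (Fin.castLE hpq i) j hij]
      split_ifs with h
      · rw [(hC s).1 ⟨i + 1, h⟩ j (Nat.lt_succ_of_lt hij)]
        simp
      · simp
    · simp only [U, Matrix.of_apply, bidiagonal_mul_apply hpq]
      rw [div_eq_one_iff_eq (hd s i)]
      split_ifs with h
      · rw [(hC s).1 ⟨i + 1, h⟩ (Fin.castLE hpq i) (Nat.lt_succ_self _), add_zero]
      · rw [add_zero]
  -- Row `n` of `K C` is the sum of rows `n` and `n + 1` of `C`. As the first row of `C` is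
  -- prescribed, the others follow recursively; `q ≤ p + 1` ensures that all of them are reached.
  have hCR : ∀ (n : ℕ) (i : Fin q), (i : ℕ) = n → ∀ j, (fun s => C s i j) ∈ R.toSubalgebra := by
    intro n
    induction n with
    | zero =>
      intro i hi j
      simpa only [(hC _).2.2 i j hi] using const_mem _
    | succ n ih =>
      intro i hi j
      have hn : n < p := by have := i.2; omega
      have h1 := ih (Fin.castLE hpq ⟨n, hn⟩) rfl
      have h2 := R.toSubalgebra.sub_mem
        (R.toSubalgebra.mul_mem (hUR ⟨n, hn⟩ j) (h1 (Fin.castLE hpq ⟨n, hn⟩))) (h1 j)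
      convert h2 using 1
      funext s
      have hq : n + 1 < q := hi ▸ i.2
      have hi' : i = ⟨n + 1, hq⟩ := Fin.ext hi
      simp only [Pi.sub_apply, Pi.mul_apply, U, Matrix.of_apply]
      rw [div_mul_cancel₀ _ (hd s _), bidiagonal_mul_apply hpq, dif_pos hq, hi']
      ring
  refine ⟨fun i k => ?_, fun i j => hCR i i rfl j⟩
  have h := div_mem (hLR i k) (hCR k (Fin.castLE hpq k) rfl (Fin.castLE hpq k)) fun s => hd s k
  convert h using 1
  funext s
  exact (mul_div_cancel_right₀ _ (hd s k)).symm

theorem entries_general (c : GeneralCase) {A : X → Matrix (Fin c.type.rows) (Fin c.type.cols) ℂ}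
    (hA : R.Entries A) {B : X → Matrix (Fin c.type.rows) (Fin c.type.rows) ℂ}
    {C : X → Matrix (Fin c.type.cols) (Fin c.type.cols) ℂ}
    (h : ∀ s, c.type.IsFactorization (A s) (B s) (C s)) : R.Entries B ∧ R.Entries C := by
  cases c with
  | lu m =>
    refine entries_lu (p := m) (q := m) le_rfl hA (fun s => ?_) (fun s => (h s).1.1)
      (fun s i j hij => (h s).1.2.1 i j hij) fun s i => (h s).1.2.2 i
    exact (h s).2.trans (congrArg (· * C s) (Matrix.mul_one (B s)))
  | modifiedLU m =>
    exact entries_bidiagonal (p := m) (q := m) le_rfl (Nat.le_succ m) hA (fun s => (h s).2)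
      (fun s => (h s).1.1) fun s => (h s).1.2
  | modifiedCholesky n =>
    exact entries_bidiagonal (p := n) (q := n + 1) (Nat.le_succ n) le_rfl hA (fun s => (h s).2)
      (fun s => (h s).1.1) fun s => (h s).1.2

/-! ### Symmetric and skew-symmetric matrices -/

section Congruence

variable {m : ℕ} {b : Fin m → ℕ} {K : Matrix (Fin m) (Fin m) ℂ}
  {A B : X → Matrix (Fin m) (Fin m) ℂ}

/-- If `A = B K Bᵀ`, then `B`, multiplied by the diagonal matrix with the same diagonal, is
regular. -/
theorem entries_mul_diag (hA : R.Entries A) (hB : ∀ s, ScalarBlock b (B s))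
    (hK : ∀ i j, b i ≠ b j → K i j = 0)
    (hK' : ∀ k, (∃ j ε, ε ≠ 0 ∧ b j = b k ∧ ∀ l, K l j = if l = k then ε else 0) ∨
      ∀ i, (fun s => B s i k * B s k k) ∈ R.toSubalgebra)
    (hAB : ∀ s, A s = B s * K * (B s).transpose) (i k : Fin m) :
    (fun s => B s i k * B s k k) ∈ R.toSubalgebra := by
  -- Induction on the block of column `k`, using entry `(i, j)` of `A` with `j` in that block.
  have key : ∀ (n : ℕ) (k : Fin m), b k = n →
      ∀ i, (fun s => B s i k * B s k k) ∈ R.toSubalgebra := by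
    intro n
    induction n using Nat.strong_induction_on with
    | _ n ih =>
    intro k hk i
    -- Either column `j` of `K` has its only nonzero entry `ε` in row `k`, or the claim for column
    -- `k` is given; the latter serves the zero last column of an odd skew `K`.
    obtain ⟨j, ε, hε, hjk, hj⟩ | hk' := hK' k
    swap
    · exact hk' i
    have hsum : (fun s => ∑ l, ∑ l', B s i l * K l l' * B s j l') ∈ R.toSubalgebra := by
      have := hA i j
      simp only [hAB, Matrix.mul_apply, Matrix.transpose_apply, Finset.sum_mul] at this
      convert this using 2
      exact Finset.sum_comm
    have hdiag : ∀ s l, b l = b j →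
        ∑ l', B s i l * K l l' * B s j l' = B s i l * K l j * B s j j := by
      intro s l hl
      refine Finset.sum_eq_single j (fun l' _ hl' => ?_) (by simp)
      by_cases h : b l' = b j
      · rw [(hB s).offDiag j l' h.symm hl'.symm, mul_zero]
      · rw [hK l l' (by omega), mul_zero, zero_mul]
    -- The term `l = k` is `ε * B i k * B k k`. Other terms of the block vanish by the shape of `K`,
    -- those of later blocks because `B` is lower block triangular; earlier blocks are covered by
    -- induction.
    have := mem_of_sum_mem (k := k) hsum fun l hl => ?_
    · have h2 := div_mem this (const_mem ε) fun _ => hε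
      convert h2 using 1
      funext s
      rw [hdiag s k hjk.symm, hj, if_pos rfl, (hB s).scalar j k hjk]
      field_simp
    · rcases lt_trichotomy (b l) (b j) with hlt | heq | hgt
      · have hmem : ∀ l', (fun s => B s i l * K l l' * B s j l') ∈ R.toSubalgebra := by
          intro l'
          by_cases h : b l = b l'
          · have h1 := ih (b l) (by omega) l rfl
            have h2 := ih (b l) (by omega) l' h.symm
            -- Since `B l l = B l' l'`, the product `B i l * B j l'` is that of two known functions
            -- divided by `B l l ^ 2`.
            have h3 := div_mem (R.toSubalgebra.mul_mem (R.toSubalgebra.mul_mem (h1 i)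
              (const_mem (K l l'))) (h2 j)) (h1 l)
              fun s => mul_ne_zero ((hB s).ne_zero l) ((hB s).ne_zero l)
            convert h3 using 1
            funext s
            have := (hB s).ne_zero l
            simp only [Pi.mul_apply]
            rw [(hB s).scalar l' l h.symm]
            field_simp
          · simpa only [hK l l' h, mul_zero, zero_mul] using const_mem 0
        have := R.toSubalgebra.sum_mem fun l' (_ : l' ∈ Finset.univ) => hmem l'
        convert this using 1
        funext s
        rw [Finset.sum_apply]
      · have h0 : ∀ s, ∑ l', B s i l * K l l' * B s j l' = 0 := fun s => by
          rw [hdiag s l heq, hj, if_neg hl, mul_zero, zero_mul]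
        simpa only [h0] using const_mem 0
      · have h0 : ∀ s, ∑ l', B s i l * K l l' * B s j l' = 0 := fun s => by
          refine Finset.sum_eq_zero fun l' _ => ?_
          by_cases h : b l = b l'
          · rw [(hB s).lower j l' (by omega), mul_zero]
          · rw [hK l l' h, mul_zero, zero_mul]
        simpa only [h0] using const_mem 0
  exact key (b k) k rfl i

/-- Changing the signs of the diagonal blocks of `B` does not change `B K Bᵀ`. -/
theorem exists_entries_congruence (hB : ∀ s, ScalarBlock b (B s))
    (hK : ∀ i j, b i ≠ b j → K i j = 0)
    (hP : ∀ i k, (fun s => B s i k * B s k k) ∈ R.toSubalgebra)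
    {g : Fin m → X → ℂ} (hg : ∀ k, g k ∈ R.toSubalgebra) (hgB : ∀ k s, g k s ^ 2 = B s k k ^ 2)
    (hgb : ∀ k l, b k = b l → g k = g l) :
    ∃ B' : X → Matrix (Fin m) (Fin m) ℂ, R.Entries B' ∧ (∀ s, ScalarBlock b (B' s)) ∧
      (∀ s k, B' s k k = g k s) ∧ ∀ s, B s * K * (B s).transpose = B' s * K * (B' s).transpose := by
  have hg0 : ∀ k s, g k s ≠ 0 := fun k s h => by
    have := hgB k s
    rw [h] at this
    exact (hB s).ne_zero k (by simpa using this.symm)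
  have hdiag : ∀ s k, B s k k * B s k k / g k s = g k s := fun s k => by
    rw [← sq, ← hgB, sq, mul_div_cancel_right₀ _ (hg0 k s)]
  -- Here `B' = B E` with `E` diagonal, entries `B k k / g k`. These are `±1` and constant on
  -- blocks, so `E K E = K`.
  refine ⟨fun s => Matrix.of fun i k => B s i k * B s k k / g k s,
    fun i k => div_mem (hP i k) (hg k) (hg0 k), fun s => ⟨fun i j h => ?_, fun i j h h' => ?_,
      fun i j h => ?_, fun i => ?_⟩, hdiag, fun s => ?_⟩
  · simp [(hB s).lower i j h]
  · simp [(hB s).offDiag i j h h']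
  · exact (hdiag s i).trans ((congrFun (hgb i j h) s).trans (hdiag s j).symm)
  · exact (hdiag s i).trans_ne (hg0 i s)
  · ext i j
    simp only [Matrix.mul_apply, Matrix.transpose_apply, Matrix.of_apply, Finset.sum_mul]
    refine Finset.sum_congr rfl fun l _ => Finset.sum_congr rfl fun k _ => ?_
    by_cases h : b k = b l
    · have h1 : g l = g k := hgb l k h.symm
      have h2 := hgB k s
      have h3 := hg0 k s
      rw [h1, (hB s).scalar l k h.symm, div_mul_eq_mul_div, div_mul_div_comm, eq_div_iff (by simp [h3])]
      linear_combination B s i k * K k l * B s j l * h2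
    · rw [hK k l h]
      ring

end Congruence

/-- Square roots of partial products yield square roots of the factors. -/
theorem exists_sqrt_of_prod {n : ℕ} {q : Fin n → X → ℂ} (hq : ∀ i s, q i s ≠ 0)
    (h : ∀ j : Fin n, ∃ c : ℂ, c ≠ 0 ∧ ∃ f ∈ R.toSubalgebra, ∀ s,
      f s ^ 2 = c * ∏ i : Fin (j + 1), q (Fin.castLE j.2 i) s) (j : Fin n) :
    ∃ g ∈ R.toSubalgebra, ∀ s, g s ^ 2 = q j s := by
  -- Absorb the constants and include the empty product, so that each `q j` is the square of a
  -- quotient of consecutive roots, also for `j = 0`.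
  have H : ∀ (k : ℕ) (hk : k ≤ n), ∃ f ∈ R.toSubalgebra, ∀ s,
      f s ^ 2 = ∏ i : Fin k, q (Fin.castLE hk i) s := by
    rintro (_ | k) hk
    · exact ⟨fun _ => 1, const_mem 1, fun s => by simp⟩
    · obtain ⟨c, hc, f, hf, hfs⟩ := h ⟨k, hk⟩
      obtain ⟨r, hr⟩ := IsAlgClosed.exists_pow_nat_eq c two_pos
      have hr0 : r ≠ 0 := fun h0 => hc (by rw [← hr, h0]; simp)
      refine ⟨_, div_mem hf (const_mem r) fun _ => hr0, fun s => ?_⟩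
      rw [div_pow, hfs, hr, mul_div_cancel_left₀ _ hc]
  obtain ⟨f, hf, hfs⟩ := H j j.2.le
  obtain ⟨f', hf', hfs'⟩ := H (j + 1) j.2
  have hprod : ∀ s, ∏ i : Fin (j : ℕ), q (Fin.castLE j.2.le i) s ≠ 0 := fun s =>
    Finset.prod_ne_zero_iff.2 fun i _ => hq _ s
  have hf0 : ∀ s, f s ≠ 0 := fun s h0 => hprod s (by rw [← hfs, h0]; simp)
  refine ⟨_, div_mem hf' hf hf0, fun s => ?_⟩
  rw [div_pow, hfs, hfs', Fin.prod_univ_castSucc]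
  exact mul_div_cancel_left₀ _ (hprod s)

end RegularAlgebra


/-! ### Basic relative invariants in terms of the diagonal of `B` -/

theorem scalarBlock_of_mem_lowerBorel {m : ℕ} {B : Matrix (Fin m) (Fin m) ℂ}
    (hB : B ∈ lowerBorel m) : ScalarBlock (fun i => (i : ℕ)) B where
  lower i j h := hB.1 i j h
  offDiag i j h h' := absurd (Fin.ext h) h'
  scalar i j h := by rw [Fin.ext h]
  ne_zero := hB.2

theorem scalarBlock_of_mem_skewBorel {m : ℕ} {B : Matrix (Fin m) (Fin m) ℂ}
    (hB : B ∈ skewBorel m) : ScalarBlock (fun i => (i : ℕ) / 2) B :=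
  ⟨hB.1, hB.2.1, hB.2.2.1, hB.2.2.2.1⟩

theorem det_corner {m k : ℕ} (hk : k ≤ m) {B : Matrix (Fin m) (Fin m) ℂ}
    (hB : B ∈ lowerBorel m) :
    (corner B k hk).det = ∏ i : Fin k, B (Fin.castLE hk i) (Fin.castLE hk i) :=
  Matrix.det_of_isLowerTriangular (corner B k hk) fun _ _ hij => hB.1 _ _ hij

theorem det_corner_mul_transpose {m k : ℕ} (hk : k ≤ m) {B : Matrix (Fin m) (Fin m) ℂ}
    (hB : B ∈ lowerBorel m) :
    (corner (B * 1 * B.transpose) k hk).det =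
      ∏ i : Fin k, B (Fin.castLE hk i) (Fin.castLE hk i) ^ 2 := by
  have h1 : (corner (1 : Matrix (Fin m) (Fin m) ℂ) k hk) = 1 :=
    Matrix.submatrix_one _ (Fin.castLE_injective hk)
  rw [corner_mul_mul _ hB.1, h1, mul_one, Matrix.det_mul, Matrix.det_transpose, det_corner hk hB,
    Finset.prod_pow, sq]

/-- The first index of the `i`-th `2 × 2` block. -/
def blockIndex {m : ℕ} (i : Fin (m / 2)) : Fin m :=
  ⟨2 * i, by have := i.2; omega⟩

/-- The Pfaffian acquires the factor `det` of the corner of `B`, to which a block `r • 1`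
contributes `r ^ 2`. The Pfaffian of `skewJ` stays unevaluated: only its nonvanishing matters later.
-/
theorem pfaffian_corner_mul_transpose {m k : ℕ} (hk : k * 2 ≤ m) (hk' : k ≤ m / 2)
    {B : Matrix (Fin m) (Fin m) ℂ} (hB : B ∈ skewBorel m) :
    pfaffian (corner (B * skewJ m * B.transpose) (k * 2) hk) =
      pfaffian (corner (skewJ m) (k * 2) hk) *
        ∏ i : Fin k, B (blockIndex (Fin.castLE hk' i)) (blockIndex (Fin.castLE hk' i)) ^ 2 := by
  rw [corner_mul_mul _ (skewBorel_subset hB).1, pfaffian_mul_mul_transpose,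
    det_corner hk (skewBorel_subset hB), mul_comm, ← finProdFinEquiv.prod_comp,
    Fintype.prod_prod_type]
  congr 1
  refine Finset.prod_congr rfl fun i _ => ?_
  have h : ∀ a : Fin 2, B (Fin.castLE hk (finProdFinEquiv (i, a)))
      (Fin.castLE hk (finProdFinEquiv (i, a))) =
      B (blockIndex (Fin.castLE hk' i)) (blockIndex (Fin.castLE hk' i)) := fun a =>
    hB.2.2.1 _ _ (by
      have := a.2
      simp only [Fin.val_castLE, finProdFinEquiv_apply_val, blockIndex]
      omega)
  rw [Fin.prod_univ_two, h, h, sq]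

/-! ### Regular factorizations when the obstruction vanishes -/

namespace RegularAlgebra

variable {X : Type u} [TopologicalSpace X] (R : RegularAlgebra X)

/-- The basic relative invariants of a family have square roots, if the obstruction vanishes. -/
theorem exists_sqrt_invariant [LocallyPathConnectedSpace X] (κ : SymmetryKind) (m : ℕ)
    (A : X → Matrix (Fin m) (Fin m) ℂ) (hA : Continuous A)
    (h : ∀ s, ∃ B C, (κ.type m).IsFactorization (A s) B C)
    (hω : (κ.omega2 m).comp (H1map (κ.familyMap m A hA h)) = 0) (j : Fin (κ.rank m))
    (hR : (fun s => κ.invariant m j (A s)) ∈ R.toSubalgebra) :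
    ∃ f ∈ R.toSubalgebra, ∀ s, f s ^ 2 = κ.invariant m j (A s) := by
  let g : C(X, PuncturedPlane) := (κ.invariantMap m j).comp (κ.familyMap m A hA h)
  have hg : ∀ v, Even (dlogPairingInt g v) := by
    intro v
    -- The `j`-th component of the hypothesis, evaluated at `v`.
    have h1 : ((dlogPairingInt (κ.invariantMap m j)
        (H1map (κ.familyMap m A hA h) v) : ℤ) : ZMod 2) = 0 :=
      congrFun (DFunLike.congr_fun hω v) j
    rw [dlogPairingInt_H1map] at h1
    exact (ZMod.intCast_eq_zero_iff_even).1 h1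
  obtain ⟨f, hf, hloc⟩ := exists_sqrt g hg
  exact ⟨f, R.sqrt_mem (fun s => g s) hR (fun s => (g s).2) f hloc, hf⟩

variable {R}

theorem prod_mem {ι : Type*} [Fintype ι] {f : ι → X → ℂ} (hf : ∀ i, f i ∈ R.toSubalgebra) :
    (fun s => ∏ i, f i s) ∈ R.toSubalgebra := by
  have := R.toSubalgebra.prod_mem fun i (_ : i ∈ Finset.univ) => hf i
  convert this using 1
  funext s
  rw [Finset.prod_apply]

/-- A symmetric or skew-symmetric family with vanishing obstruction has a regular factorization. -/
theorem exists_entries_factorization [LocallyPathConnectedSpace X] (κ : SymmetryKind) (m : ℕ)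
    (A : X → Matrix (Fin m) (Fin m) ℂ) (hA : Continuous A)
    (h : ∀ s, ∃ B C, (κ.type m).IsFactorization (A s) B C)
    (hω : (κ.omega2 m).comp (H1map (κ.familyMap m A hA h)) = 0) (hAR : R.Entries A) :
    ∃ B C : X → Matrix (Fin m) (Fin m) ℂ, R.Entries B ∧ R.Entries C ∧
      ∀ s, (κ.type m).IsFactorization (A s) (B s) (C s) := by
  suffices H : ∃ B : X → Matrix (Fin m) (Fin m) ℂ, R.Entries B ∧
      (∀ s, B s ∈ κ.group m) ∧ ∀ s, A s = B s * κ.center m * (B s).transpose by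
    obtain ⟨B, hBR, hB, hAB⟩ := H
    exact ⟨B, fun s => (B s).transpose, hBR, fun i j => hBR j i, fun s => ⟨⟨hB s, rfl⟩, hAB s⟩⟩
  have hsqrt := exists_sqrt_invariant R κ m A hA h hω
  clear hω
  have hfac : ∀ s, ∃ B : Matrix (Fin m) (Fin m) ℂ,
      B ∈ κ.group m ∧ A s = B * κ.center m * B.transpose := fun s => by
    obtain ⟨B, C, hBC⟩ := h s
    have h1 := hBC.2
    have h2 : C = Matrix.transpose B := hBC.1.2
    rw [h2] at h1
    exact ⟨B, hBC.1.1, h1⟩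
  -- A pointwise choice without any regularity; only the signs of its blocks will need correction.
  choose B hB hAB using hfac
  cases κ with
  | symmetric =>
    change ∀ s, B s ∈ lowerBorel m at hB
    change ∀ s, A s = B s * 1 * (B s).transpose at hAB
    have hb := fun s => scalarBlock_of_mem_lowerBorel (hB s)
    have hK : ∀ i j : Fin m, (i : ℕ) ≠ j → (1 : Matrix (Fin m) (Fin m) ℂ) i j = 0 :=
      fun i j hij => Matrix.one_apply_ne fun h => hij (congrArg _ h)
    have hP := entries_mul_diag hAR hb hK
      (fun k => Or.inl ⟨k, 1, one_ne_zero, rfl, fun l => Matrix.one_apply⟩) hAB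
    have hinv : ∀ (j : Fin m) s, SymmetryKind.symmetric.invariant m j (A s) =
        ∏ i : Fin (j + 1), B s (Fin.castLE j.2 i) (Fin.castLE j.2 i) ^ 2 := fun j s => by
      rw [hAB]
      exact det_corner_mul_transpose j.2 (hB s)
    have hq : ∀ k : Fin m, (fun s => B s k k ^ 2) ∈ R.toSubalgebra := fun k => by
      simpa only [sq] using hP k k
    have hg := exists_sqrt_of_prod (R := R) (q := fun k s => B s k k ^ 2)
      (fun k s => pow_ne_zero 2 ((hB s).2 k)) fun j => by
        obtain ⟨f, hf, hfs⟩ := hsqrt j (by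
          simp only [hinv]
          exact prod_mem fun i => hq _)
        exact ⟨1, one_ne_zero, f, hf, fun s => by rw [hfs, hinv, one_mul]⟩
    choose g hgR hgs using hg
    obtain ⟨B', hB'R, hB', -, hB'B⟩ := exists_entries_congruence hb hK hP hgR hgs
      fun k l hkl => by rw [Fin.ext hkl]
    exact ⟨B', hB'R, fun s => ⟨(hB' s).lower, (hB' s).ne_zero⟩,
      fun s => (hAB s).trans (hB'B s)⟩
  | skewSymmetric =>
    change ∀ s, B s ∈ skewBorel m at hB
    change ∀ s, A s = B s * skewJ m * (B s).transpose at hAB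
    have hb := fun s => scalarBlock_of_mem_skewBorel (hB s)
    have hK : ∀ i j : Fin m, (i : ℕ) / 2 ≠ (j : ℕ) / 2 → skewJ m i j = 0 := by
      intro i j hij
      simp only [skewJ, Matrix.of_apply, Nat.even_iff]
      split_ifs <;> first | rfl | omega
    -- The partner of an even `k` is `k + 1`, with `ε = -1`; that of an odd `k` is `k - 1`, with `ε
    -- = 1`. For odd `m` the last index has no partner, but there column `k` of `B` is the standard
    -- basis vector.
    have hP := entries_mul_diag hAR hb hK (fun k => by
      rcases Nat.even_or_odd (k : ℕ) with hk | hk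
      · by_cases hkm : (k : ℕ) + 1 < m
        · refine Or.inl ⟨⟨k + 1, hkm⟩, -1, by simp, ?_, fun l => ?_⟩
          · rw [Nat.even_iff] at hk
            simp only
            omega
          · simp only [skewJ, Matrix.of_apply, Nat.even_iff, Fin.ext_iff] at hk ⊢
            split_ifs <;> first | rfl | omega
        · right
          have hk1 : (k : ℕ) + 1 = m := by have := k.2; omega
          have hm : Odd m := hk1 ▸ hk.add_one
          intro i
          rw [Nat.even_iff] at hk
          by_cases hik : i = k
          · subst hik
            simpa only [(hB _).2.2.2.2 i hm hk1, mul_one] using const_mem 1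
          · have h0 : ∀ s, B s i k = 0 := fun s => (hB s).1 i k (by
              have := i.2
              have : (i : ℕ) ≠ k := fun h => hik (Fin.ext h)
              omega)
            simpa only [h0, zero_mul] using const_mem 0
      · rw [Nat.odd_iff] at hk
        refine Or.inl ⟨⟨k - 1, by have := k.2; omega⟩, 1, one_ne_zero, ?_, fun l => ?_⟩
        · simp only
          omega
        · simp only [skewJ, Matrix.of_apply, Nat.even_iff, Fin.ext_iff]
          split_ifs <;> first | rfl | omega) hAB
    have hinv : ∀ (j : Fin (m / 2)) s, SymmetryKind.skewSymmetric.invariant m j (A s) =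
        pfaffian (corner (skewJ m) ((j + 1) * 2) (by have := j.2; omega)) *
          ∏ i : Fin (j + 1), B s (blockIndex (Fin.castLE j.2 i))
            (blockIndex (Fin.castLE j.2 i)) ^ 2 := fun j s => by
      rw [hAB]
      exact pfaffian_corner_mul_transpose _ j.2 (hB s)
    have hq : ∀ k : Fin m, (fun s => B s k k ^ 2) ∈ R.toSubalgebra := fun k => by
      simpa only [sq] using hP k k
    have hg := exists_sqrt_of_prod (R := R)
      (q := fun (k : Fin (m / 2)) s => B s (blockIndex k) (blockIndex k) ^ 2)
      (fun k s => pow_ne_zero 2 ((hb s).ne_zero _)) fun j => by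
        obtain ⟨f, hf, hfs⟩ := hsqrt j (by
          simp only [hinv]
          exact R.toSubalgebra.mul_mem (const_mem _) (prod_mem fun i => hq _))
        exact ⟨_, pfaffian_corner_skewJ_ne_zero (m := m) (k := j + 1) (by have := j.2; omega), f, hf,
          fun s => by rw [hfs, hinv]⟩
    choose g hgR hgs using hg
    -- The roots are indexed by blocks and must be spread over indices. The default `1` occurs only
    -- at the unpaired last index of an odd `m`, where the diagonal entry has to be `1`.
    let g' : Fin m → X → ℂ := fun k =>
      if hk : (k : ℕ) / 2 < m / 2 then g ⟨k / 2, hk⟩ else fun _ => 1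
    obtain ⟨B', hB'R, hB', hB'g, hB'B⟩ := exists_entries_congruence (g := g') hb hK hP
      (fun k => by
        simp only [g']
        split_ifs
        · exact hgR _
        · exact const_mem 1)
      (fun k s => by
        simp only [g']
        split_ifs with hk
        · rw [hgs, (hb s).scalar (blockIndex ⟨k / 2, hk⟩) k (by simp [blockIndex])]
        · have := k.2
          rw [(hB s).2.2.2.2 k (by rw [Nat.odd_iff]; omega) (by omega)])
      (fun k l hkl => by simp only [g', hkl])
    refine ⟨B', hB'R, fun s => ⟨(hB' s).lower, (hB' s).offDiag, (hB' s).scalar, (hB' s).ne_zero,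
      fun i hm hi => ?_⟩, fun s => (hAB s).trans (hB'B s)⟩
    rw [hB'g]
    rw [Nat.odd_iff] at hm
    simp only [g']
    rw [dif_neg (by omega)]

/-! ### The two instances: continuous and smooth functions -/

/-- The algebra of continuous functions. -/
def continuousFunctions (X : Type u) [TopologicalSpace X] : RegularAlgebra X where
  carrier := {f | Continuous f}
  mul_mem' hf hg := Continuous.mul hf hg
  add_mem' hf hg := Continuous.add hf hg
  algebraMap_mem' _ := continuous_const
  inv_mem _ hf h0 := Continuous.inv₀ hf h0
  sqrt_mem g hg hg0 h hh := by
    refine continuous_iff_continuousAt.2 fun x => ?_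
    refine ContinuousAt.congr (f := fun y => h x * Complex.exp (Complex.log (g y / g x) / 2)) ?_
      ((hh x).mono fun _ h => h.symm)
    have h1 : ContinuousAt (fun y => g y / g x) x :=
      (Continuous.div_const hg (g x)).continuousAt
    have h2 : ContinuousAt (fun y => Complex.log (g y / g x)) x :=
      h1.clog (by simp [div_self (hg0 x)])
    fun_prop

open scoped ContDiff Manifold

/-- The algebra of smooth functions on a manifold. -/
def smoothFunctions {E H : Type*} [NormedAddCommGroup E] [NormedSpace ℝ E] [TopologicalSpace H]
    (I : ModelWithCorners ℝ E H) (X : Type u) [TopologicalSpace X] [ChartedSpace H X] :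
    RegularAlgebra X where
  carrier := {f | ContMDiff I 𝓘(ℝ, ℂ) ∞ f}
  mul_mem' hf hg := (contDiff_mul (𝕜 := ℝ) (𝔸 := ℂ)).contMDiff.comp (hf.prodMk_space hg)
  add_mem' hf hg := (contDiff_add (𝕜 := ℝ) (F := ℂ)).contMDiff.comp (hf.prodMk_space hg)
  algebraMap_mem' _ := contMDiff_const
  inv_mem f hf h0 := fun x =>
    ((contDiffAt_inv ℝ (h0 x)).contMDiffAt (n := ∞)).comp x (hf x)
  sqrt_mem g hg hg0 h hh := by
    intro x
    refine ContMDiffAt.congr_of_eventuallyEq (f := (fun z : ℂ =>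
      h x * Complex.exp (Complex.log (z / g x) / 2)) ∘ g) ?_ (hh x)
    refine ContMDiffAt.comp x (ContDiffAt.contMDiffAt ?_) (hg x)
    -- The outer function is smooth over `ℂ` because `z / g x` is near `1`, away from the cut;
    -- restriction of scalars then gives real smoothness.
    have h1 : ContDiffAt ℂ ∞ (fun z : ℂ => h x * Complex.exp (Complex.log (z / g x) / 2)) (g x) := by
      have h2 : ContDiffAt ℂ ∞ (fun z : ℂ => Complex.log (z / g x)) (g x) :=
        (Complex.contDiffAt_log (by simp [div_self (hg0 x)])).comp (g x)
          (contDiffAt_id.div_const (g x))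
      exact contDiffAt_const.mul (h2.div_const 2).cexp
    exact h1.restrict_scalars ℝ

theorem entries_continuousFunctions {p q : ℕ} {A : X → Matrix (Fin p) (Fin q) ℂ} :
    (continuousFunctions X).Entries A ↔ Continuous A :=
  ⟨fun h => continuous_pi fun i => continuous_pi fun j => h i j,
    fun h i j => h.matrix_elem i j⟩

end RegularAlgebra

end CholeskyFamilies

end

theorem corollary5p1 {X : Type*} [TopologicalSpace X] [LocallyPathConnectedSpace X] :
    -- the cases of general matrices
    (∀ (c : CholeskyFamilies.GeneralCase)
      (A : X → Matrix (Fin c.type.rows) (Fin c.type.cols) ℂ),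
      (∀ s, ∃ B C, c.type.IsFactorization (A s) B C) →
        (Continuous A → CholeskyFamilies.HasContinuousFactorization c.type A) ∧
        (∀ {E H : Type*} [NormedAddCommGroup E] [NormedSpace ℝ E] [TopologicalSpace H]
          (I : ModelWithCorners ℝ E H) [ChartedSpace H X] [IsManifold I ∞ X],
          CholeskyFamilies.SmoothFamily I A →
            CholeskyFamilies.HasSmoothFactorization I c.type A)) ∧
    -- the symmetric and skew-symmetric cases
    (∀ (κ : CholeskyFamilies.SymmetryKind) (m : ℕ) (A : X → Matrix (Fin m) (Fin m) ℂ)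
      (hA : Continuous A) (h : ∀ s, ∃ B C, (κ.type m).IsFactorization (A s) B C),
      (κ.omega2 m).comp (CholeskyFamilies.H1map (κ.familyMap m A hA h)) = 0 →
        CholeskyFamilies.HasContinuousFactorization (κ.type m) A ∧
        (∀ {E H : Type*} [NormedAddCommGroup E] [NormedSpace ℝ E] [TopologicalSpace H]
          (I : ModelWithCorners ℝ E H) [ChartedSpace H X] [IsManifold I ∞ X],
          CholeskyFamilies.SmoothFamily I A →
            CholeskyFamilies.HasSmoothFactorization I (κ.type m) A)) := by
  open CholeskyFamilies RegularAlgebra in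
  refine ⟨fun c A h => ?_, fun κ m A hA h hω => ⟨?_, ?_⟩⟩
  -- The arbitrary pointwise factors serve unchanged as the regular ones.
  · choose B C hBC using h
    refine ⟨fun hA => ?_, fun I _ _ hA => ?_⟩
    · obtain ⟨hB, hC⟩ := entries_general (R := continuousFunctions X) c
        (entries_continuousFunctions.2 hA) hBC
      exact ⟨B, C, entries_continuousFunctions.1 hB, entries_continuousFunctions.1 hC, hBC⟩
    · obtain ⟨hB, hC⟩ := entries_general (R := smoothFunctions I X) c hA hBC
      exact ⟨B, C, hB, hC, hBC⟩
  · obtain ⟨B, C, hB, hC, hBC⟩ := exists_entries_factorization (R := continuousFunctions X) κ m A hA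
      h hω (entries_continuousFunctions.2 hA)
    exact ⟨B, C, entries_continuousFunctions.1 hB, entries_continuousFunctions.1 hC, hBC⟩
  · intro E H _ _ _ I _ _ hA'
    exact exists_entries_factorization (R := smoothFunctions I X) κ m A hA h hω hA'
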